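/- Let $\Sigma$ be a finite alphabet, let $T$ be the shift on $\Sigma^{\mathbb N}$, and let $X\subseteq\Sigma^{\mathbb N}$ be a subshift (closed, $T(X)\subseteq X$) with language $L(X)$, the set of finite words that appear in sequences of $X$. For a word $\sigma$ write $P(\sigma)$ for the measure of the cylinder $[\sigma]$ and $P(\sigma\tau\mid\sigma)=P(\sigma\tau)/P(\sigma)$. Let $P$ be a $T$-invariant Borel probability measure on $\Sigma^{\mathbb N}$ such that - $P$ is $L(X)$-supported: $P(\sigma)=0$ if and only if $\sigma\notin L(X)$; - $P$ is $k$-step Markov for some $k\in\mathbb N$: $P(\sigma\tau\mid\sigma)=P(\rho\tau\mid\rho)$ for all words $\sigma,\tau$ with $|\sigma|\ge k$ and $P(\sigma)>0$, where $\rho$ is the word of the last $k$ symbols of $\sigma$; - $P$ is irreducible: for all words $\sigma,\tau$ with $P(\sigma),P(\tau)>0$ there is a word $\rho$ with $P(\sigma\rho\tau)>0$. A sequence $s\in X$ is called $P$-distributed if $\lim_{N}\frac1N\sum_{n=0}^{N-1}g(T^n s)=\int_X g\,dP$ for every continuous $g\colon X\to\mathbb R$. A $P$-martingale is a function $f\colon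 L(X)\to[0,\infty)$ with $f(\sigma)=\sum_{a\in\Sigma,\ \sigma a\in L(X)}P(\sigma a\mid\sigma)f(\sigma a)$ for all $\sigma\in L(X)$. It is generated by a DFA if there are a deterministic finite automaton with state set $Q$, initial state $q_0$ and extended transition function $\delta^*$ that accepts exactly $L(X)$, and a function $b\colon Q\times\Sigma\to\mathbb R$, such that $f(\sigma a)=b(\delta^*(\sigma,q_0),a)\,f(\sigma)$ whenever $\sigma a\in L(X)$. It succeeds on $s\in X$ if $\limsup_N f(s_0\dots s_{N-1})=\infty$. Then, for every $s\in X$, the sequence $s$ is $P$-distributed if and only if no $P$-martingale generated by a DFA succeeds on $s$. Moreover, if $s\in X$ is not $P$-distributed, then there is a $P$-martingale $f$ generated by a DFA that succeeds on $s$ and whose betting factors $f(\sigma a)/f(\sigma)$, $\sigma a\in L(X)$, all belong to $\{\,1,\ 1+\delta,\ 1-\delta p^*/(1-p^*)\,\}$ for some rational $\delta>0$ and some $p^*\in(0,1)$ such that $\delta p^*/(1-p^*)<1$ and such that $p^*=P(\tau\rho\mid\tau)$ or $p^*=1-P(\tau\rho\mid\tau)$ for some words $\tau,\rho$ with $P(\tau)>0$.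 -/

import Mathlib

open MeasureTheory Filter Topology

namespace SymbolicDynamics

variable {α : Type*}

/-- The shift map `T` on one-sided sequences: `(T s) n = s (n + 1)`. -/
def shift (s : ℕ → α) : ℕ → α := fun n => s (n + 1)

/-- The word made of the first `N` symbols of `s`. -/
def initialWord (s : ℕ → α) (N : ℕ) : List α := (List.range N).map s

/-- The cylinder of all sequences that extend the word `w`. -/
def wordCylinder (w : List α) : Set (ℕ → α) := {s | initialWord s w.length = w}

/-- `X` is (the space of) a subshift: closed in the product topology and mapped into itself
by the shift. -/
def IsSubshift [TopologicalSpace α] (X : Set (ℕ → α)) : Prop :=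
  IsClosed X ∧ Set.MapsTo shift X X

/-- The language of `X`: all words that appear, at some position, in some sequence of `X`. -/
def languageOf (X : Set (ℕ → α)) : Language α :=
  {w | ∃ s ∈ X, ∃ i : ℕ, shift^[i] s ∈ wordCylinder w}

/-- `P(σ τ ∣ σ)`, the conditional probability of the cylinder of `σ τ` given the cylinder
of `σ`.  It is meaningful when the cylinder of `σ` has positive measure. -/
noncomputable def condProb [MeasurableSpace α] (P : Measure (ℕ → α)) (σ τ : List α) : ℝ :=
  P.real (wordCylinder (σ ++ τ)) / P.real (wordCylinder σ)

/-- `P` is `L`-supported: the words whose cylinders are null are exactly those outside `L`. -/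
def IsSupportedOn [MeasurableSpace α] (P : Measure (ℕ → α)) (L : Language α) : Prop :=
  ∀ w : List α, P (wordCylinder w) = 0 ↔ w ∉ L

/-- `P` is (homogeneous) `k`-step Markov: given a past `σ` of length at least `k`, the
probability of a continuation `τ` depends only on the last `k` symbols of `σ`.  Only pasts of
positive probability are considered, as otherwise the conditional probability is undefined. -/
def IsMarkovStep [MeasurableSpace α] (k : ℕ) (P : Measure (ℕ → α)) : Prop :=
  ∀ σ τ : List α, k ≤ σ.length → P (wordCylinder σ) ≠ 0 →
    condProb P σ τ = condProb P (σ.rtake k) τ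

/-- `P` is irreducible: any two words of positive probability can be joined. -/
def IsIrreducibleMeasure [MeasurableSpace α] (P : Measure (ℕ → α)) : Prop :=
  ∀ σ τ : List α, 0 < P (wordCylinder σ) → 0 < P (wordCylinder τ) →
    ∃ ρ : List α, 0 < P (wordCylinder (σ ++ ρ ++ τ))

/-- The sequence `s` of the subshift `X` is `P`-distributed: for every real function that is
continuous on `X`, the averages along the orbit of `s` converge to the integral over `X`. -/
def IsDistributed [TopologicalSpace α] [MeasurableSpace α] (X : Set (ℕ → α))
    (P : Measure (ℕ → α)) (s : ℕ → α) : Prop :=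
  ∀ g : (ℕ → α) → ℝ, ContinuousOn g X →
    Tendsto (fun N : ℕ => (∑ n ∈ Finset.range N, g (shift^[n] s)) / (N : ℝ)) atTop
      (𝓝 (∫ x in X, g x ∂P))

open scoped Classical in
/-- `f` is a (nonnegative) `P`-martingale on the language `L`.  Only the values of `f` on `L`
matter. -/
def IsMartingaleOn [Fintype α] [MeasurableSpace α] (P : Measure (ℕ → α)) (L : Language α)
    (f : List α → ℝ) : Prop :=
  (∀ σ ∈ L, 0 ≤ f σ) ∧
  ∀ σ ∈ L, f σ = ∑ a : α with σ ++ [a] ∈ L, condProb P σ [a] * f (σ ++ [a])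

/-- `f` is generated by a DFA: some finite deterministic automaton `M` accepts exactly `L`, and
the factor by which `f` changes at the next symbol depends only on that symbol and on the
state that `M` has reached. -/
def IsGeneratedByDFA (L : Language α) (f : List α → ℝ) : Prop :=
  ∃ (Q : Type) (_ : Finite Q) (M : DFA α Q) (b : Q → α → ℝ),
    M.accepts = L ∧ ∀ (σ : List α) (a : α), σ ++ [a] ∈ L →
      f (σ ++ [a]) = b (M.eval σ) a * f σ

/-- `f` succeeds on `s`: the upper limit of its values on the prefixes of `s` is `∞`. -/
def Succeeds (f : List α → ℝ) (s : ℕ → α) : Prop :=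
  limsup (fun N : ℕ => (f (initialWord s N) : EReal)) atTop = ⊤

/-- All betting factors `f (σ a) / f σ` of `f` on the language `L` belong to `B`. -/
def BettingFactorsIn (L : Language α) (f : List α → ℝ) (B : Set ℝ) : Prop :=
  ∀ (σ : List α) (a : α), σ ++ [a] ∈ L → f (σ ++ [a]) / f σ ∈ B

end SymbolicDynamics

/-!
A sequence `s` of `X` is `P`-distributed iff every word `w` has frequency `P [w]` in `s`
(`isDistributed_iff`).  Frequencies are handled as limits of Cesàro averages along ultrafilters
(`mean`), which always exist, are linear and shift invariant, and decide convergence.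

*A sequence that is not distributed is beaten.*  If, for all words `τ` of length at least `k` and
all symbols `a`, the frequency of `a` after `τ` were asymptotically `P(τ a ∣ τ)`, every
ultrafilter limit of the word frequencies would be an invariant weight with the transition
probabilities of `P`; by irreducibility there is only one
(`IsInvariantWeight.eq_of_transitions_eq`), so `s` would be distributed.  Hence some deviation is
at least `ε N` for infinitely many `N`, up to its sign.  Betting a small rational `δ` on the next
symbol being `a`, or on its not being `a`, whenever `τ` has just been read, gives a capital whose
logarithm is a positive multiple of `δ` times the deviation up to `O(δ² N)`
(`exists_succeeding_bet`).

*A distributed sequence is not beaten.*  Let an automaton run on a distributed `s`, with a memory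
of `k` symbols added to its state.  For a state `q`, the joint frequency of `q` and a word `u` read
from then on is at most `P [u]`, so its quotient by `P [u]` is an `L²`-bounded martingale and its
increments vanish in mean.  As the state after a long word is a function of the state before it,
shift invariance turns this into the exact statement that a symbol `a` follows the state `q` with
the conditional frequency that `P` prescribes (`mean_jointOcc_singleton`).  Along times at which the
capital tends to infinity the mean of the logarithm of the betting factor is nonnegative; by
`log b ≤ b - 1` and fairness it is nonpositive, with equality only if the factor is `1` on all
transitions of positive frequency.  The states of positive frequency are reached and never left, so
the capital is eventually constant (`not_succeeds_of_isDistributed`).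
-/

namespace SymbolicDynamics

/-! ### Words and cylinders -/

section Words

variable {α : Type*}

lemma shift_iterate_apply (s : ℕ → α) (n m : ℕ) : shift^[n] s m = s (n + m) := by
  induction n generalizing s with
  | zero => simp
  | succ n ih =>
    rw [Function.iterate_succ_apply, ih, shift]
    congr 1
    omega

@[simp] lemma length_initialWord (s : ℕ → α) (N : ℕ) : (initialWord s N).length = N := by
  simp [initialWord]

@[simp] lemma initialWord_zero (s : ℕ → α) : initialWord s 0 = [] := rfl

lemma initialWord_succ (s : ℕ → α) (N : ℕ) :
    initialWord s (N + 1) = initialWord s N ++ [s N] := by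
  simp [initialWord, List.range_succ]

lemma initialWord_add (s : ℕ → α) (N M : ℕ) :
    initialWord s (N + M) = initialWord s N ++ initialWord (shift^[N] s) M := by
  induction M with
  | zero => simp
  | succ M ih => rw [← add_assoc, initialWord_succ, ih, initialWord_succ, shift_iterate_apply,
      List.append_assoc]

lemma mem_wordCylinder {s : ℕ → α} {w : List α} :
    s ∈ wordCylinder w ↔ initialWord s w.length = w := Iff.rfl

lemma mem_wordCylinder_initialWord (s : ℕ → α) (N : ℕ) : s ∈ wordCylinder (initialWord s N) := by
  simp [mem_wordCylinder]

@[simp] lemma wordCylinder_nil : wordCylinder ([] : List α) = Set.univ := by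
  ext s; simp [mem_wordCylinder]

lemma mem_wordCylinder_append {s : ℕ → α} {u v : List α} :
    s ∈ wordCylinder (u ++ v) ↔ s ∈ wordCylinder u ∧ shift^[u.length] s ∈ wordCylinder v := by
  simp only [mem_wordCylinder, List.length_append, initialWord_add]
  exact ⟨fun h => List.append_inj h (by simp), fun h => by rw [h.1, h.2]⟩

lemma mem_wordCylinder_singleton {s : ℕ → α} {a : α} : s ∈ wordCylinder [a] ↔ s 0 = a := by
  simp [mem_wordCylinder, initialWord]

lemma shift_iterate_mem_singleton {s : ℕ → α} {n : ℕ} {a : α} :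
    shift^[n] s ∈ wordCylinder [a] ↔ s n = a := by
  simp [mem_wordCylinder_singleton, shift_iterate_apply]

lemma shift_iterate_mem_append {s : ℕ → α} {n : ℕ} {u v : List α} :
    shift^[n] s ∈ wordCylinder (u ++ v) ↔
      shift^[n] s ∈ wordCylinder u ∧ shift^[n + u.length] s ∈ wordCylinder v := by
  rw [mem_wordCylinder_append, ← Function.iterate_add_apply, add_comm u.length n]

lemma mem_wordCylinder_iff_forall {s : ℕ → α} {w : List α} :
    s ∈ wordCylinder w ↔ ∀ i (h : i < w.length), s i = w[i] := by
  rw [mem_wordCylinder, List.ext_getElem_iff]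
  simp [initialWord]

lemma rtake_of_length_le {w : List α} {k : ℕ} (h : w.length ≤ k) : w.rtake k = w := by
  simp [List.rtake, Nat.sub_eq_zero_of_le h]

lemma length_rtake (w : List α) (k : ℕ) : (w.rtake k).length = min k w.length := by
  simp only [List.rtake, List.length_drop]; omega

lemma rtake_append_of_le_length {u v : List α} {k : ℕ} (h : k ≤ v.length) :
    (u ++ v).rtake k = v.rtake k := by
  rw [List.rtake_eq_reverse_take_reverse, List.rtake_eq_reverse_take_reverse, List.reverse_append,
    List.take_append_of_le_length (by simpa using h)]

lemma rtake_suffix (w : List α) (k : ℕ) : w.rtake k <:+ w := List.drop_suffix _ _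

lemma rtake_rtake {w : List α} {k m : ℕ} (h : k ≤ m) : (w.rtake m).rtake k = w.rtake k := by
  simp only [List.rtake_eq_reverse_take_reverse, List.reverse_reverse, List.take_take,
    min_eq_left h]

lemma rtake_rtake_append (w v : List α) (k : ℕ) :
    (w.rtake k ++ v).rtake k = (w ++ v).rtake k := by
  simp only [List.rtake_eq_reverse_take_reverse, List.reverse_append, List.reverse_reverse,
    List.take_append, List.take_take]
  congr 3
  omega

lemma suffix_iff_rtake_eq {τ σ : List α} : τ <:+ σ ↔ σ.rtake τ.length = τ := by
  rw [List.suffix_iff_eq_drop, List.rtake, eq_comm]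

lemma suffix_initialWord_iff {s : ℕ → α} {τ : List α} {n : ℕ} :
    τ <:+ initialWord s (n + τ.length) ↔ shift^[n] s ∈ wordCylinder τ := by
  rw [initialWord_add, suffix_iff_rtake_eq, rtake_append_of_le_length (by simp),
    rtake_of_length_le (by simp), mem_wordCylinder]

lemma exists_ofFn_eq (w : List α) {n : ℕ} (h : w.length = n) :
    ∃ u : Fin n → α, List.ofFn u = w := by
  subst h; exact ⟨w.get, List.ofFn_get w⟩

lemma isClopen_wordCylinder [TopologicalSpace α] [DiscreteTopology α] (w : List α) :
    IsClopen (wordCylinder w) := by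
  have : wordCylinder w = ⋂ i : Fin w.length, (fun s : ℕ → α => s i) ⁻¹' {w[i]} := by
    ext s; simp [mem_wordCylinder_iff_forall, Fin.forall_iff]
  rw [this]
  exact isClopen_iInter_of_finite fun i =>
    (isClopen_discrete _).preimage (continuous_apply _)

end Words

/-! ### Sums over the words of a given length -/

section Sums

variable {α : Type*} [Fintype α]

lemma sum_words_succ_right (g : List α → ℝ) (n : ℕ) :
    ∑ u : Fin (n + 1) → α, g (List.ofFn u) =
      ∑ u : Fin n → α, ∑ a, g (List.ofFn u ++ [a]) := by
  rw [← (Fin.snocEquiv fun _ : Fin (n + 1) => α).sum_comp, Fintype.sum_prod_type_right]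
  refine Finset.sum_congr rfl fun u _ => Finset.sum_congr rfl fun a _ => ?_
  congr 1
  rw [List.ofFn_succ', List.concat_eq_append]
  simp [Fin.snocEquiv]

/-- A system of nonnegative weights on words that is compatible with extension by one symbol on
either side.  These are the measures of cylinders of shift-invariant measures; the formulation
by words lets limits of empirical frequencies be treated without constructing a measure. -/
structure IsInvariantWeight (μ : List α → ℝ) : Prop where
  nonneg : ∀ w, 0 ≤ μ w
  sum_right : ∀ w, μ w = ∑ a, μ (w ++ [a])
  sum_left : ∀ w, μ w = ∑ a, μ (a :: w)

namespace IsInvariantWeight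

variable {μ : List α → ℝ}

lemma append_singleton_le (hμ : IsInvariantWeight μ) (w : List α) (a : α) : μ (w ++ [a]) ≤ μ w := by
  rw [hμ.sum_right w]
  exact Finset.single_le_sum (f := fun a => μ (w ++ [a])) (fun _ _ => hμ.nonneg _)
    (Finset.mem_univ a)

lemma append_le_left (hμ : IsInvariantWeight μ) (u v : List α) : μ (u ++ v) ≤ μ u := by
  induction v using List.reverseRecOn with
  | nil => simp
  | append_singleton v a ih =>
    rw [← List.append_assoc]
    exact (hμ.append_singleton_le _ a).trans ih

lemma append_le_right (hμ : IsInvariantWeight μ) (u v : List α) : μ (u ++ v) ≤ μ v := by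
  induction u with
  | nil => simp
  | cons a u ih =>
    refine le_trans ?_ ih
    rw [hμ.sum_left (u ++ v)]
    exact Finset.single_le_sum (f := fun a => μ (a :: (u ++ v))) (fun _ _ => hμ.nonneg _)
      (Finset.mem_univ a)

lemma sum_words (hμ : IsInvariantWeight μ) (n : ℕ) : ∑ u : Fin n → α, μ (List.ofFn u) = μ [] := by
  induction n with
  | zero => simp
  | succ n ih => rw [sum_words_succ_right, ← ih]; simp only [← hμ.sum_right]

end IsInvariantWeight

end Sums

/-! ### Cylinder probabilities and the language -/

section Measure

variable {α : Type*} [Fintype α] [TopologicalSpace α] [DiscreteTopology α]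

variable [MeasurableSpace α] [BorelSpace α]

lemma measurableSet_wordCylinder (w : List α) : MeasurableSet (wordCylinder w) :=
  (isClopen_wordCylinder w).isOpen.measurableSet

lemma measureReal_eq_sum_inter_preimage (P : Measure (ℕ → α)) [IsProbabilityMeasure P]
    (A : Set (ℕ → α)) (n : ℕ) :
    P.real A = ∑ a, P.real (A ∩ {s | s n = a}) := by
  have h := sum_measureReal_preimage_singleton (μ := P.restrict A) Finset.univ
    (f := fun s : ℕ → α => s n) fun a _ => measurable_pi_apply n (measurableSet_singleton a)
  rw [Finset.coe_univ, Set.preimage_univ, measureReal_restrict_apply_univ] at h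
  rw [← h]
  refine Finset.sum_congr rfl fun a _ => ?_
  rw [measureReal_restrict_apply (measurable_pi_apply n (measurableSet_singleton a)),
    Set.inter_comm]
  rfl

lemma isInvariantWeight_measureReal (P : Measure (ℕ → α)) [IsProbabilityMeasure P]
    (hinv : MeasurePreserving (shift (α := α)) P P) :
    IsInvariantWeight fun w => P.real (wordCylinder w) where
  nonneg _ := measureReal_nonneg
  sum_right w := by
    rw [measureReal_eq_sum_inter_preimage P _ w.length]
    refine Finset.sum_congr rfl fun a _ => congrArg P.real ?_
    ext s
    simp [mem_wordCylinder_append, mem_wordCylinder_singleton, shift_iterate_apply]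
  sum_left w := by
    rw [← hinv.measureReal_preimage (measurableSet_wordCylinder w).nullMeasurableSet,
      measureReal_eq_sum_inter_preimage P _ 0]
    refine Finset.sum_congr rfl fun a _ => congrArg P.real ?_
    ext s
    rw [← List.singleton_append, mem_wordCylinder_append, mem_wordCylinder_singleton]
    simp [and_comm]

end Measure

section Language

variable {α : Type*} [MeasurableSpace α] {P : Measure (ℕ → α)}

lemma condProb_nonneg (σ τ : List α) : 0 ≤ condProb P σ τ :=
  div_nonneg measureReal_nonneg measureReal_nonneg

lemma wordCylinder_ne_zero_iff [IsProbabilityMeasure P] {w : List α} :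
    P (wordCylinder w) ≠ 0 ↔ 0 < P.real (wordCylinder w) := by
  rw [measureReal_def, ENNReal.toReal_pos_iff, pos_iff_ne_zero]
  simp [measure_lt_top]

lemma IsSupportedOn.mem_iff [IsProbabilityMeasure P] {L : Language α} (h : IsSupportedOn P L)
    {w : List α} :
    w ∈ L ↔ 0 < P.real (wordCylinder w) := by
  rw [← wordCylinder_ne_zero_iff, ne_eq, h w, not_not]

lemma IsSupportedOn.measureReal_eq_zero {L : Language α} (h : IsSupportedOn P L) {w : List α}
    (hw : w ∉ L) : P.real (wordCylinder w) = 0 := by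
  rw [measureReal_def, (h w).2 hw, ENNReal.toReal_zero]

end Language

section Measure

variable {α : Type*} [Fintype α] [TopologicalSpace α] [DiscreteTopology α]
  [MeasurableSpace α] [BorelSpace α] {P : Measure (ℕ → α)} [IsProbabilityMeasure P]

lemma condProb_mul (hinv : MeasurePreserving (shift (α := α)) P P) (σ τ : List α) :
    condProb P σ τ * P.real (wordCylinder σ) = P.real (wordCylinder (σ ++ τ)) := by
  rcases eq_or_ne (P.real (wordCylinder σ)) 0 with h | h
  · rw [h, mul_zero]
    exact le_antisymm measureReal_nonneg
      (((isInvariantWeight_measureReal P hinv).append_le_left σ τ).trans h.le)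
  · rw [condProb, div_mul_cancel₀ _ h]

lemma condProb_pos_iff (hinv : MeasurePreserving (shift (α := α)) P P) {σ τ : List α} :
    0 < condProb P σ τ ↔ 0 < P.real (wordCylinder (σ ++ τ)) := by
  constructor
  · intro h
    rw [← condProb_mul hinv]
    refine mul_pos h (measureReal_nonneg.lt_of_ne' fun h0 => ?_)
    simp [condProb, h0] at h
  · intro h
    exact div_pos h (h.trans_le ((isInvariantWeight_measureReal P hinv).append_le_left σ τ))

lemma sum_condProb (hinv : MeasurePreserving (shift (α := α)) P P) {σ : List α}
    (h : 0 < P.real (wordCylinder σ)) : ∑ a, condProb P σ [a] = 1 := by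
  simp only [condProb]
  rw [← Finset.sum_div, ← (isInvariantWeight_measureReal P hinv).sum_right, div_self h.ne']

/-- A `k`-step Markov measure is `m`-step Markov for all `m ≥ k`, also for pasts shorter
than `m`. -/
lemma IsMarkovStep.condProb_rtake {k : ℕ} (hM : IsMarkovStep k P)
    (hinv : MeasurePreserving (shift (α := α)) P P) {m : ℕ} (hkm : k ≤ m) {σ : List α}
    (hσ : 0 < P.real (wordCylinder σ)) (τ : List α) :
    condProb P σ τ = condProb P (σ.rtake m) τ := by
  rcases le_total σ.length m with h | h
  · rw [rtake_of_length_le h]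
  · have hpos : 0 < P.real (wordCylinder (σ.rtake m)) := by
      obtain ⟨u, hu⟩ := rtake_suffix σ m
      have := (isInvariantWeight_measureReal P hinv).append_le_right u (σ.rtake m)
      rw [hu] at this
      exact hσ.trans_le this
    rw [hM σ τ (hkm.trans h) (wordCylinder_ne_zero_iff.2 hσ),
      hM (σ.rtake m) τ (by rw [length_rtake]; omega) (wordCylinder_ne_zero_iff.2 hpos),
      rtake_rtake hkm]

end Measure

lemma shift_iterate_mem {α : Type*} {X : Set (ℕ → α)} (hX : Set.MapsTo shift X X) {s : ℕ → α}
    (hs : s ∈ X) (n : ℕ) : shift^[n] s ∈ X := hX.iterate n hs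

lemma mem_languageOf {α : Type*} {X : Set (ℕ → α)} {s : ℕ → α} (hs : s ∈ X) {w : List α} {n : ℕ}
    (h : shift^[n] s ∈ wordCylinder w) : w ∈ languageOf X := ⟨s, hs, n, h⟩

lemma initialWord_mem_languageOf {α : Type*} {X : Set (ℕ → α)} {s : ℕ → α} (hs : s ∈ X) (n : ℕ) :
    initialWord s n ∈ languageOf X :=
  mem_languageOf (n := 0) hs (mem_wordCylinder_initialWord s n)

/-! ### Ultrafilter limits of Cesàro averages -/

/-- The average of the first `N` values of `φ`. -/
noncomputable def cesaro (φ : ℕ → ℝ) (N : ℕ) : ℝ := (∑ n ∈ Finset.range N, φ n) / N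

/-- The limit of the averages of `φ` along the ultrafilter `U`.  It is meaningful when `φ` is
bounded, as the limit then exists. -/
noncomputable def mean (U : Ultrafilter ℕ) (φ : ℕ → ℝ) : ℝ := limUnder (U : Filter ℕ) (cesaro φ)

/-- `φ` is bounded in absolute value. -/
def IsBdd (φ : ℕ → ℝ) : Prop := ∃ C, ∀ n, |φ n| ≤ C

section Mean

variable {φ ψ : ℕ → ℝ}

lemma IsBdd.const_mul (h : IsBdd φ) (c : ℝ) : IsBdd fun n => c * φ n := by
  obtain ⟨C, hC⟩ := h
  exact ⟨|c| * C, fun n => by rw [abs_mul]; exact mul_le_mul_of_nonneg_left (hC n) (abs_nonneg c)⟩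

lemma IsBdd.add (h : IsBdd φ) (h' : IsBdd ψ) : IsBdd fun n => φ n + ψ n := by
  obtain ⟨C, hC⟩ := h
  obtain ⟨D, hD⟩ := h'
  exact ⟨C + D, fun n => (abs_add_le _ _).trans (add_le_add (hC n) (hD n))⟩

lemma IsBdd.sum {ι : Type*} (t : Finset ι) {f : ι → ℕ → ℝ} (h : ∀ i ∈ t, IsBdd (f i)) :
    IsBdd fun n => ∑ i ∈ t, f i n := by
  classical
  induction t using Finset.induction_on with
  | empty => exact ⟨0, by simp⟩
  | insert i t hi ih =>
    simp only [Finset.sum_insert hi]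
    exact (h i (Finset.mem_insert_self i t)).add
      (ih fun j hj => h j (Finset.mem_insert_of_mem hj))

lemma IsBdd.comp (h : IsBdd φ) (g : ℕ → ℕ) : IsBdd fun n => φ (g n) :=
  h.imp fun _ hC n => hC (g n)

lemma abs_cesaro_le {C : ℝ} (hC : ∀ n, |φ n| ≤ C) (N : ℕ) : |cesaro φ N| ≤ C := by
  have hC0 : 0 ≤ C := (abs_nonneg _).trans (hC 0)
  rw [cesaro, abs_div, Nat.abs_cast]
  refine div_le_of_le_mul₀ (Nat.cast_nonneg N) hC0 ?_
  refine (Finset.abs_sum_le_sum_abs _ _).trans ((Finset.sum_le_sum fun n _ => hC n).trans ?_)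
  simp [mul_comm]

lemma tendsto_mean (U : Ultrafilter ℕ) (h : IsBdd φ) :
    Tendsto (cesaro φ) U (𝓝 (mean U φ)) := by
  obtain ⟨C, hC⟩ := h
  obtain ⟨x, -, hx⟩ := (isCompact_Icc (a := -C) (b := C)).ultrafilter_le_nhds
    (U.map (cesaro φ)) (le_principal_iff.2 (Filter.mem_map.2
      (Filter.Eventually.of_forall fun N => abs_le.1 (abs_cesaro_le hC N))))
  exact tendsto_nhds_limUnder ⟨x, hx⟩

lemma mean_eq {U : Ultrafilter ℕ} {x : ℝ} (h : Tendsto (cesaro φ) U (𝓝 x)) : mean U φ = x :=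
  h.limUnder_eq

lemma mean_nonneg (U : Ultrafilter ℕ) (h : IsBdd φ) (h0 : ∀ n, 0 ≤ φ n) : 0 ≤ mean U φ :=
  ge_of_tendsto' (tendsto_mean U h) fun _ =>
    div_nonneg (Finset.sum_nonneg fun n _ => h0 n) (Nat.cast_nonneg _)

lemma mean_const_mul (U : Ultrafilter ℕ) (h : IsBdd φ) (c : ℝ) :
    mean U (fun n => c * φ n) = c * mean U φ := by
  refine mean_eq (((tendsto_mean U h).const_mul c).congr fun N => ?_)
  simp only [cesaro, ← Finset.mul_sum, mul_div_assoc]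

lemma mean_add (U : Ultrafilter ℕ) (h : IsBdd φ) (h' : IsBdd ψ) :
    mean U (fun n => φ n + ψ n) = mean U φ + mean U ψ := by
  refine mean_eq (((tendsto_mean U h).add (tendsto_mean U h')).congr fun N => ?_)
  simp only [cesaro, Finset.sum_add_distrib, add_div]

lemma mean_zero (U : Ultrafilter ℕ) : mean U (fun _ => 0) = 0 :=
  mean_eq (tendsto_const_nhds.congr fun N => by simp [cesaro])

lemma mean_sum {ι : Type*} (U : Ultrafilter ℕ) (t : Finset ι) {f : ι → ℕ → ℝ}
    (h : ∀ i ∈ t, IsBdd (f i)) :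
    mean U (fun n => ∑ i ∈ t, f i n) = ∑ i ∈ t, mean U (f i) := by
  classical
  induction t using Finset.induction_on with
  | empty => simpa using mean_zero U
  | insert i t hi ih =>
    have ht := fun j hj => h j (Finset.mem_insert_of_mem hj)
    simp only [Finset.sum_insert hi]
    rw [mean_add U (h i (Finset.mem_insert_self i t)) (IsBdd.sum t ht), ih ht]

lemma mean_mono (U : Ultrafilter ℕ) (h : IsBdd φ) (h' : IsBdd ψ) (hle : ∀ n, φ n ≤ ψ n) :
    mean U φ ≤ mean U ψ :=
  le_of_tendsto_of_tendsto' (tendsto_mean U h) (tendsto_mean U h') fun N =>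
    div_le_div_of_nonneg_right (Finset.sum_le_sum fun n _ => hle n) (Nat.cast_nonneg N)

variable {U : Ultrafilter ℕ}

lemma mean_one (hU : (U : Filter ℕ) ≤ atTop) : mean U (fun _ => 1) = 1 := by
  refine mean_eq ((tendsto_const_nhds (x := (1 : ℝ))).congr' ?_)
  filter_upwards [hU (eventually_gt_atTop 0)] with N hN
  have : (N : ℝ) ≠ 0 := by exact_mod_cast hN.ne'
  simp [cesaro, this]

lemma mean_comp_succ (hU : (U : Filter ℕ) ≤ atTop) (h : IsBdd φ) :
    mean U (fun n => φ (n + 1)) = mean U φ := by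
  obtain ⟨C, hC⟩ := h
  have h0 : Tendsto (fun N : ℕ => (φ N - φ 0) / N) U (𝓝 0) := by
    refine Tendsto.mono_left ?_ hU
    refine squeeze_zero_norm (fun N => ?_) (tendsto_const_div_atTop_nhds_zero_nat (C + C))
    rw [norm_div, Real.norm_eq_abs, Real.norm_natCast]
    exact div_le_div_of_nonneg_right ((abs_sub _ _).trans (add_le_add (hC N) (hC 0)))
      (Nat.cast_nonneg N)
  refine mean_eq ?_
  have := (tendsto_mean U ⟨C, hC⟩).add h0
  rw [add_zero] at this
  refine this.congr fun N => ?_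
  rw [cesaro, cesaro, ← add_div]
  congr 1
  have := Finset.sum_range_succ' φ N
  rw [Finset.sum_range_succ] at this
  linarith

lemma mean_comp_add (hU : (U : Filter ℕ) ≤ atTop) (h : IsBdd φ) (m : ℕ) :
    mean U (fun n => φ (n + m)) = mean U φ := by
  induction m with
  | zero => rfl
  | succ m ih =>
    rw [← ih, ← mean_comp_succ hU (h.comp fun n => n + m)]
    simp only [add_assoc, add_comm 1 m]

lemma exists_pos_of_mean_pos (h : IsBdd φ) (hpos : 0 < mean U φ) : ∃ n, 0 < φ n := by
  by_contra! hle
  have := mean_mono U h (ψ := fun _ => 0) ⟨0, by simp⟩ hle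
  rw [mean_zero] at this
  exact absurd hpos this.not_gt

end Mean

/-- Averages converge as soon as they have the same limit along all ultrafilters. -/
lemma tendsto_cesaro_of_mean_eq {φ : ℕ → ℝ} (h : IsBdd φ) {x : ℝ}
    (hx : ∀ U : Ultrafilter ℕ, (U : Filter ℕ) ≤ atTop → mean U φ = x) :
    Tendsto (cesaro φ) atTop (𝓝 x) := by
  rw [tendsto_iff_ultrafilter]
  intro U hU
  rw [← hx U hU]
  exact tendsto_mean U h

/-! ### Uniqueness of the invariant weight with given transition probabilities -/

section Uniqueness

variable {α : Type*} [Fintype α] {μ ν : List α → ℝ}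

lemma IsInvariantWeight.exists_pos (hν : IsInvariantWeight ν) (h : 0 < ν []) (k : ℕ) :
    ∃ w : List α, w.length = k ∧ 0 < ν w := by
  by_contra! hle
  rw [← hν.sum_words k] at h
  exact absurd h (Finset.sum_nonpos fun u _ => hle _ (by simp)).not_gt

/-- The hypothesis `htrans` says that `μ` has the transition probabilities of `ν` after pasts of
length at least `k`.  The proof is that of the uniqueness of the stationary distribution of an
irreducible chain: if `c` is the least value of `μ / ν` on words of length `k`, attained at
`w₀`, then `μ - c ν` is nonnegative and vanishes at `w₀`, hence at every word from which `w₀`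
can be reached. -/
theorem IsInvariantWeight.eq_of_transitions_eq (hμ : IsInvariantWeight μ)
    (hν : IsInvariantWeight ν) (hμ1 : μ [] = 1) (hν1 : ν [] = 1) (k : ℕ)
    (hirr : ∀ u v, 0 < ν u → 0 < ν v → ∃ r, 0 < ν (u ++ r ++ v))
    (hzero : ∀ w, ν w = 0 → μ w = 0)
    (htrans : ∀ w a, k ≤ w.length → μ (w ++ [a]) * ν w = ν (w ++ [a]) * μ w) : μ = ν := by
  have hpos : ∀ {w}, ν w ≠ 0 → 0 < ν w := fun h => (hν.nonneg _).lt_of_ne' h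
  -- the transition probabilities agree also for words `v` in place of symbols
  have hext : ∀ w v, k ≤ w.length → μ (w ++ v) * ν w = ν (w ++ v) * μ w := by
    intro w v hw
    induction v using List.reverseRecOn with
    | nil => simp [mul_comm]
    | append_singleton v a ih =>
      rw [← List.append_assoc]
      by_cases h0 : ν (w ++ v) = 0
      · have h1 : ν (w ++ v ++ [a]) = 0 :=
          le_antisymm ((hν.append_singleton_le _ a).trans h0.le) (hν.nonneg _)
        rw [h1, hzero _ h1]; ring
      · have := htrans (w ++ v) a (by simp; omega)
        refine mul_right_cancel₀ h0 ?_
        calc _ = μ (w ++ v ++ [a]) * ν (w ++ v) * ν w := by ring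
          _ = ν (w ++ v ++ [a]) * (μ (w ++ v) * ν w) := by rw [this]; ring
          _ = _ := by rw [ih]; ring
  obtain ⟨w₁, hw₁, hw₁pos⟩ := hν.exists_pos (by rw [hν1]; exact one_pos) k
  have hfin : {w : List α | w.length = k ∧ 0 < ν w}.Finite :=
    (List.finite_length_eq α k).subset fun w hw => hw.1
  obtain ⟨w₀, ⟨hw₀, hw₀pos⟩, hmin⟩ :=
    Set.exists_min_image _ (fun w => μ w / ν w) hfin ⟨w₁, hw₁, hw₁pos⟩
  set c := μ w₀ / ν w₀ with hc
  have hge : ∀ w, k ≤ w.length → c * ν w ≤ μ w := by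
    intro w hw
    by_cases h0 : ν w = 0
    · rw [h0, hzero w h0, mul_zero]
    have hu : 0 < ν (w.take k) := (hpos h0).trans_le (by
      simpa using hν.append_le_left (w.take k) (w.drop k))
    have h1 := hmin (w.take k) ⟨by simpa using hw, hu⟩
    have h2 := hext (w.take k) (w.drop k) (by simpa using hw)
    rw [List.take_append_drop] at h2
    rw [le_div_iff₀ hu] at h1
    refine le_of_mul_le_mul_right ?_ hu
    rw [h2]
    nlinarith [hν.nonneg w]
  -- the nonnegative numbers `(μ - c ν) (b :: u ++ w₀)` sum to `(μ - c ν) (u ++ w₀) = 0`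
  have hpre : ∀ u, μ (u ++ w₀) = c * ν (u ++ w₀) := by
    intro u
    induction u with
    | nil => rw [List.nil_append, hc, div_mul_cancel₀ _ hw₀pos.ne']
    | cons a u ih =>
      have hsum : ∑ b, (μ (b :: (u ++ w₀)) - c * ν (b :: (u ++ w₀))) = 0 := by
        rw [Finset.sum_sub_distrib, ← Finset.mul_sum, ← hμ.sum_left, ← hν.sum_left, ih, sub_self]
      rw [Finset.sum_eq_zero_iff_of_nonneg fun b _ => sub_nonneg.2 (hge _ (by simp; omega))]
        at hsum
      exact sub_eq_zero.1 (hsum a (Finset.mem_univ a))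
  have hbase : ∀ v, k ≤ v.length → μ v = c * ν v := by
    intro v hv
    by_cases h0 : ν v = 0
    · rw [h0, hzero v h0, mul_zero]
    obtain ⟨r, hr⟩ := hirr v w₀ (hpos h0) hw₀pos
    have h1 := hext v (r ++ w₀) hv
    rw [← List.append_assoc, hpre] at h1
    refine mul_left_cancel₀ hr.ne' ?_
    rw [← h1]; ring
  have hall : ∀ j, ∀ v : List α, k ≤ v.length + j → μ v = c * ν v := by
    intro j
    induction j with
    | zero => exact hbase
    | succ j ih =>
      intro v hv
      rw [hμ.sum_right, hν.sum_right v, Finset.mul_sum]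
      exact Finset.sum_congr rfl fun a _ => ih _ (by simp; omega)
  have hc1 : c = 1 := by
    have := hall k [] (by simp)
    rw [hμ1, hν1, mul_one] at this
    exact this.symm
  funext v
  rw [hall k v (by omega), hc1, one_mul]

end Uniqueness

/-! ### Word frequencies and distribution -/

/-- The indicator that `w` occurs in `s` at position `n`. -/
noncomputable def occ {α : Type*} (s : ℕ → α) (w : List α) (n : ℕ) : ℝ :=
  (wordCylinder w).indicator (fun _ => 1) (shift^[n] s)

section Occ

variable {α : Type*} {s : ℕ → α} {w : List α} {n : ℕ}

lemma occ_of_mem (h : shift^[n] s ∈ wordCylinder w) : occ s w n = 1 :=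
  Set.indicator_of_mem h _

lemma occ_of_notMem (h : shift^[n] s ∉ wordCylinder w) : occ s w n = 0 :=
  Set.indicator_of_notMem h _

lemma occ_nonneg (s : ℕ → α) (w : List α) (n : ℕ) : 0 ≤ occ s w n :=
  Set.indicator_nonneg (fun _ _ => zero_le_one) _

lemma occ_le_one (s : ℕ → α) (w : List α) (n : ℕ) : occ s w n ≤ 1 :=
  Set.indicator_le' (fun _ _ => le_rfl) (fun _ _ => zero_le_one) _

lemma isBdd_occ (s : ℕ → α) (w : List α) : IsBdd (occ s w) :=
  ⟨1, fun n => by rw [abs_of_nonneg (occ_nonneg s w n)]; exact occ_le_one s w n⟩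

@[simp] lemma occ_nil (s : ℕ → α) (n : ℕ) : occ s [] n = 1 := by simp [occ]

lemma occ_append (s : ℕ → α) (u v : List α) (n : ℕ) :
    occ s (u ++ v) n = occ s u n * occ s v (n + u.length) := by
  by_cases hu : shift^[n] s ∈ wordCylinder u
  · rw [occ_of_mem hu, one_mul]
    by_cases hv : shift^[n + u.length] s ∈ wordCylinder v
    · rw [occ_of_mem hv, occ_of_mem (shift_iterate_mem_append.2 ⟨hu, hv⟩)]
    · rw [occ_of_notMem hv, occ_of_notMem fun h => hv (shift_iterate_mem_append.1 h).2]
  · rw [occ_of_notMem hu, zero_mul, occ_of_notMem fun h => hu (shift_iterate_mem_append.1 h).1]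

lemma occ_singleton [DecidableEq α] (s : ℕ → α) (a : α) (n : ℕ) :
    occ s [a] n = if a = s n then 1 else 0 := by
  split_ifs with h
  · exact occ_of_mem (shift_iterate_mem_singleton.2 h.symm)
  · exact occ_of_notMem fun h' => h (shift_iterate_mem_singleton.1 h').symm

lemma sum_occ_singleton [Fintype α] (s : ℕ → α) (n : ℕ) : ∑ a, occ s [a] n = 1 := by
  classical simp [occ_singleton]

lemma occ_eq_sum_right [Fintype α] (s : ℕ → α) (w : List α) (n : ℕ) :
    occ s w n = ∑ a, occ s (w ++ [a]) n := by
  simp only [occ_append, ← Finset.mul_sum, sum_occ_singleton, mul_one]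

lemma occ_succ_eq_sum_left [Fintype α] (s : ℕ → α) (w : List α) (n : ℕ) :
    occ s w (n + 1) = ∑ a, occ s (a :: w) n := by
  have : ∀ a, occ s (a :: w) n = occ s [a] n * occ s w (n + 1) := fun a => occ_append s [a] w n
  simp only [this, ← Finset.sum_mul, sum_occ_singleton, one_mul]

lemma sum_occ_words [Fintype α] (s : ℕ → α) (n m : ℕ) :
    ∑ u : Fin m → α, occ s (List.ofFn u) n = 1 := by
  induction m with
  | zero => simp
  | succ m ih =>
    rw [sum_words_succ_right fun w => occ s w n, ← ih]
    simp only [← occ_eq_sum_right]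

lemma isInvariantWeight_mean_occ [Fintype α] {U : Ultrafilter ℕ} (hU : (U : Filter ℕ) ≤ atTop)
    (s : ℕ → α) : IsInvariantWeight fun w => mean U (occ s w) where
  nonneg w := mean_nonneg U (isBdd_occ s w) (occ_nonneg s w)
  sum_right w := by
    rw [← mean_sum U _ fun a _ => isBdd_occ s _]
    exact congrArg _ (funext fun n => occ_eq_sum_right s w n)
  sum_left w := by
    rw [← mean_sum U _ fun a _ => isBdd_occ s _, ← mean_comp_succ hU (isBdd_occ s w)]
    exact congrArg _ (funext fun n => occ_succ_eq_sum_left s w n)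

end Occ

section Distributed

variable {α : Type*} [TopologicalSpace α] [DiscreteTopology α]

lemma eventually_mem_of_mem_nhds {x : ℕ → α} {A : Set (ℕ → α)} (h : A ∈ 𝓝 x) :
    ∃ n, wordCylinder (initialWord x n) ⊆ A := by
  obtain ⟨_, ⟨y, n, rfl⟩, hx, hA⟩ :=
    (PiNat.isTopologicalBasis_cylinders fun _ => α).mem_nhds_iff.1 h
  refine ⟨n, fun t ht => hA ?_⟩
  rw [PiNat.mem_cylinder_iff] at hx ⊢
  intro i hi
  rw [← hx i hi, mem_wordCylinder_iff_forall.1 ht i (by simpa using hi)]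
  simp [initialWord]

/-- A continuous function on a compact set of sequences is determined up to `ε` by the
first `m` symbols, for some `m`. -/
lemma exists_abs_sub_lt_of_initialWord_eq {X : Set (ℕ → α)} (hX : IsCompact X)
    {g : (ℕ → α) → ℝ} (hg : ContinuousOn g X) {ε : ℝ} (hε : 0 < ε) :
    ∃ m, ∀ t ∈ X, ∀ t' ∈ X, initialWord t m = initialWord t' m → |g t - g t'| < ε := by
  have h1 : ∀ x ∈ X, ∃ n, ∀ t ∈ X, t ∈ wordCylinder (initialWord x n) → |g t - g x| < ε / 2 := by
    intro x hx
    have := (hg x hx).eventually (Metric.ball_mem_nhds (g x) (half_pos hε))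
    rw [eventually_nhdsWithin_iff] at this
    obtain ⟨n, hn⟩ := eventually_mem_of_mem_nhds this
    exact ⟨n, fun t ht h => by simpa [Real.dist_eq] using hn h ht⟩
  choose! n hn using h1
  obtain ⟨F, hFX, hF⟩ := hX.elim_nhds_subcover
    (fun x => wordCylinder (initialWord x (n x))) fun x _ =>
      (isClopen_wordCylinder _).isOpen.mem_nhds (mem_wordCylinder_initialWord x _)
  refine ⟨F.sup n, fun t ht t' ht' heq => ?_⟩
  obtain ⟨x, hxF, hx⟩ := Set.mem_iUnion₂.1 (hF ht)
  have hx' : t' ∈ wordCylinder (initialWord x (n x)) := by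
    obtain ⟨j, hj⟩ := Nat.exists_eq_add_of_le (Finset.le_sup (f := n) hxF)
    rw [hj, initialWord_add, initialWord_add] at heq
    have := (List.append_inj heq (by simp)).1
    rw [mem_wordCylinder, length_initialWord] at hx ⊢
    rw [← this, hx]
  have e1 := hn x (hFX x hxF) t ht hx
  have e2 := hn x (hFX x hxF) t' ht' hx'
  rw [abs_lt] at *
  constructor <;> linarith

variable [Fintype α] [MeasurableSpace α] {P : Measure (ℕ → α)}

lemma measure_compl_eq_zero {X : Set (ℕ → α)} (hX : IsSubshift X)
    (hsupp : IsSupportedOn P (languageOf X)) : P Xᶜ = 0 := by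
  have hsub : Xᶜ ⊆ ⋃ w ∈ {w : List α | w ∉ languageOf X}, wordCylinder w := by
    intro t ht
    obtain ⟨n, hn⟩ := eventually_mem_of_mem_nhds (hX.1.isOpen_compl.mem_nhds ht)
    refine Set.mem_iUnion₂.2 ⟨initialWord t n, ?_, mem_wordCylinder_initialWord t n⟩
    rintro ⟨x, hx, i, hi⟩
    exact hn hi (shift_iterate_mem hX.2 hx i)
  refine measure_mono_null hsub ((measure_biUnion_null_iff (Set.to_countable _)).2 ?_)
  exact fun w hw => (hsupp w).2 hw

variable [BorelSpace α]

lemma setIntegral_indicator_wordCylinder {X : Set (ℕ → α)} (hX0 : P Xᶜ = 0) (w : List α) :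
    ∫ x in X, (wordCylinder w).indicator (fun _ => (1 : ℝ)) x ∂P = P.real (wordCylinder w) := by
  have hr : P.restrict X = P := Measure.restrict_eq_self_of_ae_mem hX0
  rw [hr, integral_indicator_const _ (measurableSet_wordCylinder w), smul_eq_mul, mul_one]

/-- Being `P`-distributed means that all words have their `P`-probability as frequency. -/
theorem isDistributed_iff [IsProbabilityMeasure P] {X : Set (ℕ → α)} (hX : IsSubshift X)
    (hsupp : IsSupportedOn P (languageOf X)) {s : ℕ → α} (hs : s ∈ X) :
    IsDistributed X P s ↔
      ∀ w, Tendsto (cesaro (occ s w)) atTop (𝓝 (P.real (wordCylinder w))) := by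
  have hX0 := measure_compl_eq_zero hX hsupp
  have hr : P.restrict X = P := Measure.restrict_eq_self_of_ae_mem hX0
  constructor
  · intro h w
    have := h ((wordCylinder w).indicator fun _ => 1)
      ((continuous_const.indicator fun a ha => by
        simp [(isClopen_wordCylinder w).frontier_eq] at ha).continuousOn)
    rwa [setIntegral_indicator_wordCylinder hX0] at this
  · intro h g hg
    rw [Metric.tendsto_atTop']
    intro ε hε
    obtain ⟨m, hm⟩ := exists_abs_sub_lt_of_initialWord_eq hX.1.isCompact hg
      (show 0 < ε / 3 by positivity)
    -- `G` is the approximation of `g` by a function of the first `m` symbols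
    have hc : ∀ u : Fin m → α, ∃ c : ℝ, ∀ t ∈ X, t ∈ wordCylinder (List.ofFn u) →
        |g t - c| ≤ ε / 3 := by
      intro u
      by_cases hu : ∃ t ∈ X, t ∈ wordCylinder (List.ofFn u)
      · obtain ⟨t, ht, htu⟩ := hu
        refine ⟨g t, fun t' ht' htu' => (hm t' ht' t ht ?_).le⟩
        rw [mem_wordCylinder, List.length_ofFn] at htu htu'
        rw [htu, htu']
      · exact ⟨0, fun t ht htu => absurd ⟨t, ht, htu⟩ hu⟩
    choose c hc using hc
    set G : (ℕ → α) → ℝ := fun t =>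
      ∑ u : Fin m → α, c u * (wordCylinder (List.ofFn u)).indicator (fun _ => 1) t with hG
    have hgG : ∀ t ∈ X, |g t - G t| ≤ ε / 3 := by
      intro t ht
      obtain ⟨u, hu⟩ := exists_ofFn_eq (initialWord t m) (length_initialWord t m)
      have htu : t ∈ wordCylinder (List.ofFn u) := by
        rw [hu]; exact mem_wordCylinder_initialWord t m
      have : G t = c u := by
        rw [hG]
        dsimp only
        rw [Finset.sum_eq_single u]
        · rw [Set.indicator_of_mem htu, mul_one]
        · intro v _ hv
          rw [Set.indicator_of_notMem, mul_zero]
          intro htv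
          rw [mem_wordCylinder, List.length_ofFn] at htu htv
          exact hv (List.ofFn_injective (htv.symm.trans htu))
        · exact fun hu => absurd (Finset.mem_univ u) hu
      rw [this]
      exact hc u t ht htu
    have hint : ∀ u : Fin m → α, Integrable
        (fun t => c u * (wordCylinder (List.ofFn u)).indicator (fun _ => (1 : ℝ)) t) P :=
      fun u => ((integrable_const 1).indicator (measurableSet_wordCylinder _)).const_mul _
    have hGint : Integrable G P := integrable_finsetSum _ fun u _ => hint u
    have hgint : Integrable g P := by
      have := hg.integrableOn_compact (μ := P) hX.1.isCompact
      rwa [IntegrableOn, hr] at this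
    have hlimG : Tendsto (cesaro fun n => G (shift^[n] s)) atTop (𝓝 (∫ x, G x ∂P)) := by
      have h1 : ∫ x, G x ∂P = ∑ u : Fin m → α, c u * P.real (wordCylinder (List.ofFn u)) := by
        rw [integral_finsetSum _ fun u _ => hint u]
        refine Finset.sum_congr rfl fun u _ => ?_
        rw [integral_const_mul, integral_indicator_const _ (measurableSet_wordCylinder _),
          smul_eq_mul, mul_one]
      rw [h1]
      refine (tendsto_finsetSum _ fun u _ => (h (List.ofFn u)).const_mul (c u)).congr fun N => ?_
      simp only [cesaro, hG, ← mul_div_assoc, ← Finset.sum_div, Finset.mul_sum]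
      rw [Finset.sum_comm]
      rfl
    have hintG : |∫ x, g x ∂P - ∫ x, G x ∂P| ≤ ε / 3 := by
      rw [← integral_sub hgint hGint]
      have := norm_integral_le_of_norm_le_const (μ := P) (f := fun x => g x - G x) (C := ε / 3)
        (by
          have : ∀ᵐ x ∂P, x ∈ X := hX0
          filter_upwards [this] with x hx using hgG x hx)
      simpa using this
    have hsumG : ∀ N, |cesaro (fun n => g (shift^[n] s)) N -
        cesaro (fun n => G (shift^[n] s)) N| ≤ ε / 3 := by
      intro N
      have : cesaro (fun n => g (shift^[n] s)) N - cesaro (fun n => G (shift^[n] s)) N =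
          cesaro (fun n => g (shift^[n] s) - G (shift^[n] s)) N := by
        simp only [cesaro, Finset.sum_sub_distrib, sub_div]
      rw [this]
      exact abs_cesaro_le (fun n => hgG _ (shift_iterate_mem hX.2 hs n)) N
    obtain ⟨N₀, hN₀⟩ := Metric.tendsto_atTop.1 hlimG (ε / 3) (by positivity)
    refine ⟨N₀, fun N hN => ?_⟩
    have e1 := hN₀ N hN.le
    have e2 := hsumG N
    rw [hr, Real.dist_eq, abs_lt]
    rw [Real.dist_eq, abs_lt] at e1
    rw [abs_le] at e2 hintG
    change _ < cesaro (fun n => g (shift^[n] s)) N - _ ∧ cesaro (fun n => g (shift^[n] s)) N - _ < _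
    constructor <;> linarith [e1.1, e1.2, e2.1, e2.2, hintG.1, hintG.2]

end Distributed

/-! ### Automata with bounded memory -/

section Automata

variable {α : Type*}

/-- The states of an automaton that remembers the last `m` symbols it has read. -/
abbrev Memory (α : Type*) (m : ℕ) : Type _ := {v : List α // v.length ≤ m}

/-- What is remembered of the word `w`: its last `m` symbols. -/
def remember (m : ℕ) (w : List α) : Memory α m := ⟨w.rtake m, by rw [length_rtake]; omega⟩

instance [Finite α] (m : ℕ) : Finite (Memory α m) := (List.finite_length_le α m).to_subtype

lemma remember_append (m : ℕ) (w v : List α) :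
    remember m ((remember m w).1 ++ v) = remember m (w ++ v) :=
  Subtype.ext (rtake_rtake_append w v m)

/-- The automaton whose state is the last `m` symbols read together with the truth value of
"the word read so far is in `L`".  It is meaningful when membership of `w ++ [a]` in `L` depends
only on membership of `w` and on the last `m` symbols of `w`. -/
def memoryDFA (L : Language α) (m : ℕ) : DFA α (Memory α m × Prop) where
  step q a := (remember m (q.1.1 ++ [a]), q.2 ∧ q.1.1 ++ [a] ∈ L)
  start := (remember m [], True)
  accept := {q | q.2}

lemma memoryDFA_eval {L : Language α} {m : ℕ} (hnil : [] ∈ L)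
    (hL : ∀ w a, w ++ [a] ∈ L ↔ w ∈ L ∧ w.rtake m ++ [a] ∈ L) (w : List α) :
    (memoryDFA L m).eval w = (remember m w, w ∈ L) := by
  induction w using List.reverseRecOn with
  | nil => simp [memoryDFA, hnil]
  | append_singleton w a ih =>
    rw [DFA.eval_append_singleton, ih]
    exact Prod.ext (remember_append m w [a]) (propext (hL w a).symm)

lemma memoryDFA_accepts {L : Language α} {m : ℕ} (hnil : [] ∈ L)
    (hL : ∀ w a, w ++ [a] ∈ L ↔ w ∈ L ∧ w.rtake m ++ [a] ∈ L) :
    (memoryDFA L m).accepts = L := by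
  ext w
  rw [DFA.mem_accepts, memoryDFA_eval hnil hL]
  rfl

/-- The state type in `IsGeneratedByDFA` may be taken in any universe. -/
lemma isGeneratedByDFA_of_dfa {L : Language α} {f : List α → ℝ} {Q : Type*} [Finite Q]
    (M : DFA α Q) (b : Q → α → ℝ) (hM : M.accepts = L)
    (hf : ∀ (σ : List α) (a : α), σ ++ [a] ∈ L → f (σ ++ [a]) = b (M.eval σ) a * f σ) :
    IsGeneratedByDFA L f := by
  obtain ⟨n, ⟨e⟩⟩ := Finite.exists_equiv_fin Q
  refine ⟨Fin n, inferInstance, DFA.reindex e M, fun q a => b (e.symm q) a, ?_, ?_⟩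
  · rw [DFA.accepts_reindex, hM]
  · intro σ a h
    simp [hf σ a h]

end Automata

/-! ### The capital of a betting strategy -/

section Capital

variable {α : Type*}

/-- Auxiliary form of `capital` on reversed words. -/
def revCapital (β : List α → α → ℝ) : List α → ℝ
  | [] => 1
  | a :: w => revCapital β w * β w.reverse a

/-- The capital reached after `w`, from initial capital `1`, by the strategy whose betting factor
is `β w a` when the symbol `a` follows the word `w`. -/
def capital (β : List α → α → ℝ) (w : List α) : ℝ := revCapital β w.reverse

lemma capital_append_singleton (β : List α → α → ℝ) (w : List α) (a : α) :
    capital β (w ++ [a]) = capital β w * β w a := by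
  simp [capital, revCapital]

lemma capital_pos {β : List α → α → ℝ} (hβ : ∀ w a, 0 < β w a) (w : List α) :
    0 < capital β w := by
  induction w using List.reverseRecOn with
  | nil => simp [capital, revCapital]
  | append_singleton w a ih => rw [capital_append_singleton]; exact mul_pos ih (hβ w a)

lemma log_capital_initialWord {β : List α → α → ℝ} (hβ : ∀ w a, 0 < β w a) (s : ℕ → α) (N : ℕ) :
    Real.log (capital β (initialWord s N)) =
      ∑ n ∈ Finset.range N, Real.log (β (initialWord s n) (s n)) := by
  induction N with
  | zero => simp [capital, revCapital]
  | succ N ih =>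
    rw [initialWord_succ, capital_append_singleton,
      Real.log_mul (capital_pos hβ _).ne' (hβ _ _).ne', ih, Finset.sum_range_succ]

lemma succeeds_iff {f : List α → ℝ} {s : ℕ → α} :
    Succeeds f s ↔ ∀ M : ℝ, ∃ᶠ N in atTop, M < f (initialWord s N) := by
  rw [Succeeds, EReal.eq_top_iff_forall_lt]
  constructor
  · intro h M
    exact (frequently_lt_of_lt_limsup (by isBoundedDefault) (h M)).mono
      fun N hN => EReal.coe_lt_coe_iff.1 hN
  · intro h M
    have hM : ((M : ℝ) : EReal) < ((M + 1 : ℝ) : EReal) := EReal.coe_lt_coe_iff.2 (by linarith)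
    refine hM.trans_le (le_limsup_of_frequently_le ?_)
    exact (h (M + 1)).mono fun N hN => EReal.coe_le_coe_iff.2 hN.le

lemma sub_two_mul_sq_le_log {t : ℝ} (h : |t| ≤ 1 / 2) : t - 2 * t ^ 2 ≤ Real.log (1 + t) := by
  rw [abs_le] at h
  have hpos : 0 < 1 + t := by linarith [h.1]
  refine le_trans ?_ (Real.one_sub_inv_le_log_of_pos hpos)
  have : 1 - (1 + t)⁻¹ = t / (1 + t) := by field_simp; ring
  rw [this, le_div_iff₀ hpos]
  nlinarith [sq_nonneg t, mul_nonneg (sq_nonneg t) (by linarith [h.1] : 0 ≤ 1 + 2 * t)]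

end Capital

/-! ### A finite-state strategy that succeeds on a sequence with a wrong frequency -/

open scoped Classical in
/-- The indicator that the word `τ` has just been read when `n` symbols of `s` are known. -/
noncomputable def past {α : Type*} (s : ℕ → α) (τ : List α) (n : ℕ) : ℝ :=
  if τ <:+ initialWord s n then 1 else 0

section Past

variable {α : Type*}

lemma past_add_length (s : ℕ → α) (τ : List α) (n : ℕ) : past s τ (n + τ.length) = occ s τ n := by
  rw [past]
  split_ifs with h
  · exact (occ_of_mem (suffix_initialWord_iff.1 h)).symm
  · exact (occ_of_notMem fun h' => h (suffix_initialWord_iff.2 h')).symm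

lemma past_nonneg (s : ℕ → α) (τ : List α) (n : ℕ) : 0 ≤ past s τ n := by
  rw [past]; split_ifs <;> simp

lemma past_le_one (s : ℕ → α) (τ : List α) (n : ℕ) : past s τ n ≤ 1 := by
  rw [past]; split_ifs <;> simp

end Past

section Betting

variable {α : Type*} [Fintype α] [TopologicalSpace α] [DiscreteTopology α]
  [MeasurableSpace α] [BorelSpace α] {X : Set (ℕ → α)} {P : Measure (ℕ → α)}
  [IsProbabilityMeasure P] {k : ℕ}

lemma append_singleton_mem_iff (hsupp : IsSupportedOn P (languageOf X))
    (hMarkov : IsMarkovStep k P) (hinv : MeasurePreserving (shift (α := α)) P P) {m : ℕ}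
    (hkm : k ≤ m) (w : List α) (a : α) :
    w ++ [a] ∈ languageOf X ↔ w ∈ languageOf X ∧ w.rtake m ++ [a] ∈ languageOf X := by
  have hP := isInvariantWeight_measureReal P hinv
  simp only [hsupp.mem_iff]
  constructor
  · intro h
    have hw := h.trans_le (hP.append_singleton_le w a)
    refine ⟨hw, ?_⟩
    rw [← condProb_pos_iff hinv, ← hMarkov.condProb_rtake hinv hkm hw, condProb_pos_iff hinv]
    exact h
  · rintro ⟨hw, h⟩
    rw [← condProb_pos_iff hinv] at h ⊢
    rwa [hMarkov.condProb_rtake hinv hkm hw]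

/-- If frequencies conditioned on long pasts are right, all frequencies are right. -/
lemma exists_not_tendsto_of_not_isDistributed (hX : IsSubshift X)
    (hsupp : IsSupportedOn P (languageOf X)) (hinv : MeasurePreserving (shift (α := α)) P P)
    (hirr : IsIrreducibleMeasure P) (k : ℕ) {s : ℕ → α} (hs : s ∈ X)
    (hnd : ¬ IsDistributed X P s) :
    ∃ τ a, k ≤ τ.length ∧ 0 < P.real (wordCylinder τ) ∧
      ¬ Tendsto (cesaro fun n => past s τ n * (occ s [a] n - condProb P τ [a])) atTop (𝓝 0) := by
  by_contra! hall
  refine hnd ((isDistributed_iff hX hsupp hs).2 fun w =>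
    tendsto_cesaro_of_mean_eq (isBdd_occ s w) fun U hU => ?_)
  have hP := isInvariantWeight_measureReal P hinv
  refine congrFun ((isInvariantWeight_mean_occ hU s).eq_of_transitions_eq hP ?_ ?_ k ?_ ?_ ?_) w
  · simpa [funext (occ_nil s)] using mean_one hU
  · simp
  · intro u v hu hv
    obtain ⟨r, hr⟩ := hirr u v (pos_iff_ne_zero.2 (wordCylinder_ne_zero_iff.2 hu))
      (pos_iff_ne_zero.2 (wordCylinder_ne_zero_iff.2 hv))
    exact ⟨r, wordCylinder_ne_zero_iff.1 hr.ne'⟩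
  · intro v hv
    have : occ s v = fun _ => 0 := funext fun n => occ_of_notMem fun h =>
      (hsupp.mem_iff.1 (mem_languageOf hs h)).ne' hv
    rw [this, mean_zero]
  · intro τ a hτ
    rcases (hP.nonneg τ).eq_or_lt with h0 | hpos
    · have h1 : P.real (wordCylinder (τ ++ [a])) = 0 :=
        le_antisymm ((hP.append_singleton_le τ a).trans h0.symm.le) (hP.nonneg _)
      rw [← h0, h1]; ring
    · have hbdd : IsBdd fun n => past s τ n * (occ s [a] n - condProb P τ [a]) := by
        refine ⟨1 + |condProb P τ [a]|, fun n => ?_⟩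
        rw [abs_mul, abs_of_nonneg (past_nonneg s τ n)]
        have h1 : |occ s [a] n - condProb P τ [a]| ≤ 1 + |condProb P τ [a]| :=
          (abs_sub _ _).trans (by
            rw [abs_of_nonneg (occ_nonneg s _ n)]; linarith [occ_le_one s [a] n])
        nlinarith [past_nonneg s τ n, past_le_one s τ n,
          abs_nonneg (occ s [a] n - condProb P τ [a])]
      have h := mean_eq ((hall τ a hτ hpos).mono_left hU)
      rw [← mean_comp_add hU hbdd τ.length] at h
      have heq : (fun n => past s τ (n + τ.length) *
            (occ s [a] (n + τ.length) - condProb P τ [a])) =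
          fun n => occ s (τ ++ [a]) n + -condProb P τ [a] * occ s τ n := by
        funext n
        rw [past_add_length, occ_append]; ring
      rw [heq, mean_add U (isBdd_occ s _) ((isBdd_occ s τ).const_mul _),
        mean_const_mul U (isBdd_occ s τ)] at h
      rw [← condProb_mul hinv τ [a]]
      linear_combination P.real (wordCylinder τ) * h

open scoped Classical in
/-- The factors of the strategy that bets, after the word `τ`, on the next symbol being in `E`:
the factor is `x` if it is and `y` if it is not. -/
noncomputable def betAfter (τ : List α) (E : Set α) (x y : ℝ) (w : List α) (a : α) : ℝ :=
  if τ <:+ w then (if a ∈ E then x else y) else 1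

open scoped Classical in
lemma isMartingaleOn_capital_betAfter (hsupp : IsSupportedOn P (languageOf X))
    (hMarkov : IsMarkovStep k P) (hinv : MeasurePreserving (shift (α := α)) P P) {τ : List α}
    (hτ : k ≤ τ.length) {E : Set α} {x y p : ℝ} (hx : 0 < x) (hy : 0 < y)
    (hp : p = ∑ a with a ∈ E, condProb P τ [a]) (hfair : p * x + (1 - p) * y = 1) :
    IsMartingaleOn P (languageOf X) (capital (betAfter τ E x y)) := by
  have hpos : ∀ w a, 0 < betAfter τ E x y w a := by
    intro w a; rw [betAfter]; split_ifs <;> first | assumption | exact one_pos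
  refine ⟨fun σ _ => (capital_pos hpos σ).le, fun σ hσ => ?_⟩
  rw [hsupp.mem_iff] at hσ
  rw [Finset.sum_filter_of_ne]
  · simp only [capital_append_singleton]
    have : ∑ a, condProb P σ [a] * betAfter τ E x y σ a = 1 := by
      simp only [betAfter]
      split_ifs with hsuf
      · have hc : ∀ a, condProb P σ [a] = condProb P τ [a] := fun a => by
          rw [hMarkov.condProb_rtake hinv hτ hσ, suffix_iff_rtake_eq.1 hsuf]
        have h1 : ∑ a, condProb P τ [a] = 1 := by
          simp only [← hc]; exact sum_condProb hinv hσ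
        rw [← Finset.sum_filter_add_sum_filter_not _ (fun a => a ∈ E), ← hp] at h1
        rw [← Finset.sum_filter_add_sum_filter_not _ (fun a => a ∈ E)]
        rw [Finset.sum_congr rfl fun a ha => by
            rw [if_pos (Finset.mem_filter.1 ha).2, hc],
          Finset.sum_congr (s₁ := Finset.univ.filter fun a => a ∉ E) rfl fun a ha => by
            rw [if_neg (Finset.mem_filter.1 ha).2, hc],
          ← Finset.sum_mul, ← Finset.sum_mul, ← hp]
        rw [← hfair, ← h1]; ring
      · simpa using sum_condProb hinv hσ
    calc capital (betAfter τ E x y) σ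
        = (∑ a, condProb P σ [a] * betAfter τ E x y σ a) * capital (betAfter τ E x y) σ := by
          rw [this, one_mul]
      _ = _ := by
          rw [Finset.sum_mul]
          exact Finset.sum_congr rfl fun a _ => by ring
  · intro a _ hne
    by_contra hmem
    refine hne ?_
    rw [condProb, hsupp.measureReal_eq_zero hmem, zero_div, zero_mul]

lemma isGeneratedByDFA_capital_betAfter (hsupp : IsSupportedOn P (languageOf X))
    (hMarkov : IsMarkovStep k P) (hinv : MeasurePreserving (shift (α := α)) P P) {τ : List α}
    (hτ : k ≤ τ.length) (E : Set α) (x y : ℝ) :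
    IsGeneratedByDFA (languageOf X) (capital (betAfter τ E x y)) := by
  have hnil : [] ∈ languageOf X := by simp [hsupp.mem_iff]
  have hL := append_singleton_mem_iff hsupp hMarkov hinv hτ
  refine isGeneratedByDFA_of_dfa (memoryDFA (languageOf X) τ.length)
    (fun q => betAfter τ E x y q.1.1) (memoryDFA_accepts hnil hL) fun σ a _ => ?_
  rw [memoryDFA_eval hnil hL, capital_append_singleton, mul_comm]
  congr 1
  have hiff : τ <:+ σ ↔ τ <:+ (remember τ.length σ).1 := by
    rw [suffix_iff_rtake_eq, suffix_iff_rtake_eq, remember, rtake_rtake le_rfl]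
  by_cases h : τ <:+ σ
  · rw [betAfter, betAfter, if_pos h, if_pos (hiff.1 h)]
  · rw [betAfter, betAfter, if_neg h, if_neg (mt hiff.2 h)]

open scoped Classical in
/-- For small `δ` the logarithm of the capital is, up to an error `O(δ²)` per step, a positive
multiple of the deviation that is bet on; so a deviation that persists makes the capital grow
exponentially along a subsequence. -/
lemma exists_succeeding_bet (hsupp : IsSupportedOn P (languageOf X))
    (hMarkov : IsMarkovStep k P) (hinv : MeasurePreserving (shift (α := α)) P P) {τ : List α}
    (hτ : k ≤ τ.length) {E : Set α} {p : ℝ}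
    (hp : p = ∑ a with a ∈ E, condProb P τ [a]) {s : ℕ → α} (hs : s ∈ X) {ε : ℝ} (hε : 0 < ε)
    (hdev : ∃ᶠ N in atTop, ε ≤ cesaro
      (fun n => past s τ n * (E.indicator (fun _ => 1) (s n) - p)) N) :
    ∃ f : List α → ℝ, IsMartingaleOn P (languageOf X) f ∧ IsGeneratedByDFA (languageOf X) f ∧
      Succeeds f s ∧ ∃ δ : ℚ, 0 < p ∧ p < 1 ∧ 0 < δ ∧ (δ : ℝ) * p / (1 - p) < 1 ∧
        BettingFactorsIn (languageOf X) f {1, 1 + (δ : ℝ), 1 - (δ : ℝ) * p / (1 - p)} := by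
  set φ : ℕ → ℝ := fun n => past s τ n * (E.indicator (fun _ => 1) (s n) - p) with hφ
  -- some term of the deviation is positive, which forces `p < 1` and, since only words of the
  -- language occur in `s`, also `0 < p`
  have hex : ∃ n, 0 < φ n := by
    by_contra! hle
    obtain ⟨N, hN⟩ := hdev.exists
    have : cesaro φ N ≤ 0 :=
      div_nonpos_of_nonpos_of_nonneg (Finset.sum_nonpos fun n _ => hle n) (Nat.cast_nonneg N)
    linarith
  obtain ⟨n₀, hn₀⟩ := hex
  have hsuf : τ <:+ initialWord s n₀ := by
    by_contra h
    simp [hφ, past, h] at hn₀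
  have hpast : past s τ n₀ = 1 := if_pos hsuf
  have hp0' : 0 ≤ p := hp ▸ Finset.sum_nonneg fun a _ => condProb_nonneg _ _
  simp only [hφ, hpast, one_mul, sub_pos] at hn₀
  have hE : s n₀ ∈ E := by
    by_contra h
    rw [Set.indicator_of_notMem h] at hn₀
    linarith
  have hp1 : p < 1 := by rwa [Set.indicator_of_mem hE] at hn₀
  have hp0 : 0 < p := by
    have h1 : 0 < condProb P τ [s n₀] := by
      rw [condProb_pos_iff hinv, ← hsupp.mem_iff]
      obtain ⟨u, hu⟩ := hsuf
      refine mem_languageOf (n := u.length) hs ?_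
      have h := mem_wordCylinder_initialWord s (n₀ + 1)
      rw [initialWord_succ, ← hu, List.append_assoc, mem_wordCylinder_append] at h
      exact h.2
    rw [hp]
    exact h1.trans_le (Finset.single_le_sum (f := fun a => condProb P τ [a])
      (fun a _ => condProb_nonneg _ _) (by simpa using hE))
  have hq : 0 < 1 - p := sub_pos.2 hp1
  set r : ℝ := p / (1 - p) with hr
  have hr0 : 0 < r := div_pos hp0 hq
  -- the first bound keeps `δ` and `δ r` below `1 / 2`, the second makes the quadratic error at most
  -- half of the linear gain
  obtain ⟨δ, hδ0, hδ⟩ := exists_rat_btwn (show (0 : ℝ) < min (1 / (2 * (1 + r)))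
    (ε / (4 * (1 - p) * (1 + r ^ 2))) by positivity)
  have hδ1 : (δ : ℝ) < 1 / (2 * (1 + r)) := hδ.trans_le (min_le_left _ _)
  have hδ2 : (δ : ℝ) < ε / (4 * (1 - p) * (1 + r ^ 2)) := hδ.trans_le (min_le_right _ _)
  rw [lt_div_iff₀ (by positivity)] at hδ1 hδ2
  have hδr : 0 < (δ : ℝ) * r := mul_pos hδ0 hr0
  have hδhalf : (δ : ℝ) ≤ 1 / 2 := by nlinarith
  have hδrhalf : (δ : ℝ) * r ≤ 1 / 2 := by nlinarith
  have hy : 1 - (δ : ℝ) * p / (1 - p) = 1 + -(δ * r) := by rw [hr]; ring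
  set x : ℝ := 1 + δ with hx
  set y : ℝ := 1 - (δ : ℝ) * p / (1 - p) with hydef
  have hx0 : 0 < x := by rw [hx]; linarith
  have hy0 : 0 < y := by rw [hy]; linarith
  have hfair : p * x + (1 - p) * y = 1 := by rw [hx, hydef]; field_simp; ring
  have hβ : ∀ w a, 0 < betAfter τ E x y w a := by
    intro w a; rw [betAfter]; split_ifs <;> first | assumption | exact one_pos
  refine ⟨capital (betAfter τ E x y),
    isMartingaleOn_capital_betAfter hsupp hMarkov hinv hτ hx0 hy0 hp hfair,
    isGeneratedByDFA_capital_betAfter hsupp hMarkov hinv hτ E x y, ?_,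
    δ, hp0, hp1, by exact_mod_cast hδ0, ?_, ?_⟩
  · rw [succeeds_iff]
    intro M
    have hstep : ∀ n, δ / (1 - p) * φ n - 2 * δ ^ 2 * (1 + r ^ 2) ≤
        Real.log (betAfter τ E x y (initialWord s n) (s n)) := by
      intro n
      have hnn : 0 ≤ 2 * (δ : ℝ) ^ 2 * (1 + r ^ 2) := by positivity
      simp only [hφ, past, betAfter]
      split_ifs with h1 h2
      · rw [Set.indicator_of_mem h2, hx]
        refine le_trans ?_ (sub_two_mul_sq_le_log (by rw [abs_of_pos hδ0]; exact hδhalf))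
        have : (δ : ℝ) / (1 - p) * (1 * (1 - p)) = δ := by field_simp
        rw [this]
        nlinarith [mul_nonneg (sq_nonneg (δ : ℝ)) (sq_nonneg r)]
      · rw [Set.indicator_of_notMem h2, hy]
        refine le_trans ?_ (sub_two_mul_sq_le_log (by
          rw [abs_neg, abs_of_pos hδr]; exact hδrhalf))
        have : (δ : ℝ) / (1 - p) * (1 * (0 - p)) = -(δ * r) := by rw [hr]; ring
        rw [this]
        nlinarith [sq_nonneg (δ : ℝ)]
      · rw [Real.log_one]; linarith
    set c : ℝ := δ * ε / (2 * (1 - p)) with hc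
    have hc0 : 0 < c := by positivity
    have hlarge : ∀ᶠ N : ℕ in atTop, M < c * N :=
      (tendsto_natCast_atTop_atTop.const_mul_atTop hc0).eventually_gt_atTop M
    refine (hdev.and_eventually (hlarge.and (eventually_gt_atTop 0))).mono ?_
    rintro N ⟨hN, hM, hN0⟩
    have hN0' : (0 : ℝ) < N := by exact_mod_cast hN0
    have hlog : c * N ≤ Real.log (capital (betAfter τ E x y) (initialWord s N)) := by
      rw [log_capital_initialWord hβ]
      refine le_trans ?_ (Finset.sum_le_sum fun n _ => hstep n)
      rw [Finset.sum_sub_distrib, ← Finset.mul_sum, Finset.sum_const, Finset.card_range,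
        nsmul_eq_mul]
      rw [cesaro, le_div_iff₀ hN0'] at hN
      have h1 : (δ : ℝ) / (1 - p) * (ε * N) ≤ δ / (1 - p) * ∑ n ∈ Finset.range N, φ n :=
        mul_le_mul_of_nonneg_left hN (by positivity)
      have h2 : 2 * (δ : ℝ) ^ 2 * (1 + r ^ 2) ≤ c := by
        rw [hc, le_div_iff₀ (by positivity)]
        nlinarith
      have h3 : (δ : ℝ) / (1 - p) * (ε * N) = 2 * c * N := by rw [hc]; field_simp
      nlinarith
    calc M < c * N := hM
      _ ≤ Real.exp (c * N) := by linarith [Real.add_one_le_exp (c * N)]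
      _ ≤ _ := (Real.le_log_iff_exp_le (capital_pos hβ _)).1 hlog
  · rw [mul_div_assoc]; linarith
  · intro σ a _
    rw [capital_append_singleton, mul_div_cancel_left₀ _ (capital_pos hβ σ).ne', betAfter]
    split_ifs <;> simp [hx, hydef]

/-- A deviation of the frequency of `a` after `τ` is beaten by betting on `a` if it is infinitely
often too large, and by betting against `a` if it is infinitely often too small. -/
theorem exists_succeeding_martingale_of_not_isDistributed (hX : IsSubshift X)
    (hsupp : IsSupportedOn P (languageOf X)) (hMarkov : IsMarkovStep k P)
    (hinv : MeasurePreserving (shift (α := α)) P P)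
    (hirr : IsIrreducibleMeasure P) {s : ℕ → α} (hs : s ∈ X) (hnd : ¬ IsDistributed X P s) :
    ∃ f : List α → ℝ, IsMartingaleOn P (languageOf X) f ∧ IsGeneratedByDFA (languageOf X) f ∧
      Succeeds f s ∧ ∃ (δ : ℚ) (p : ℝ) (τ ρ : List α), 0 < P (wordCylinder τ) ∧
        (p = condProb P τ ρ ∨ p = 1 - condProb P τ ρ) ∧
        0 < p ∧ p < 1 ∧ 0 < δ ∧ (δ : ℝ) * p / (1 - p) < 1 ∧
        BettingFactorsIn (languageOf X) f {1, 1 + (δ : ℝ), 1 - (δ : ℝ) * p / (1 - p)} := by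
  classical
  obtain ⟨τ, a, hτ, hτpos, hnt⟩ :=
    exists_not_tendsto_of_not_isDistributed hX hsupp hinv hirr k hs hnd
  have hτpos' : 0 < P (wordCylinder τ) := pos_iff_ne_zero.2 (wordCylinder_ne_zero_iff.2 hτpos)
  set φ : ℕ → ℝ := fun n => past s τ n * (occ s [a] n - condProb P τ [a]) with hφ
  rw [Metric.tendsto_nhds] at hnt
  push Not at hnt
  obtain ⟨ε, hε, hfreq⟩ := hnt
  have hfreq' : ∃ᶠ N in atTop, ε ≤ cesaro φ N ∨ ε ≤ -cesaro φ N := by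
    refine hfreq.mono fun N hN => ?_
    rw [Real.dist_eq, sub_zero] at hN
    exact le_abs.1 hN
  rcases frequently_or_distrib.1 hfreq' with h | h
  · obtain ⟨f, h1, h2, h3, δ, h4⟩ := exists_succeeding_bet hsupp hMarkov hinv hτ
      (E := {a}) (p := condProb P τ [a]) (by
        rw [← Finset.sum_singleton (fun b => condProb P τ [b]) a]
        exact Finset.sum_congr (by ext; simp) fun _ _ => rfl) hs hε (h.mono fun N hN => by
        refine hN.trans_eq (congrFun (congrArg cesaro (funext fun n => ?_)) N)
        simp only [hφ, occ_singleton, Set.indicator_apply, Set.mem_singleton_iff, eq_comm])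
    exact ⟨f, h1, h2, h3, δ, _, τ, [a], hτpos', Or.inl rfl, h4⟩
  · obtain ⟨f, h1, h2, h3, δ, h4⟩ := exists_succeeding_bet hsupp hMarkov hinv hτ
      (E := {a}ᶜ) (p := 1 - condProb P τ [a]) (by
        have := sum_condProb hinv hτpos
        rw [← Finset.sum_filter_add_sum_filter_not _ (fun b => b = a)] at this
        rw [Finset.filter_eq' Finset.univ a, if_pos (Finset.mem_univ a),
          Finset.sum_singleton] at this
        rw [← this, add_sub_cancel_left]
        exact Finset.sum_congr (by ext; simp) fun _ _ => rfl) hs hε (h.mono fun N hN => by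
        refine hN.trans_eq ?_
        rw [cesaro, cesaro, ← neg_div, ← Finset.sum_neg_distrib]
        congr 1
        refine Finset.sum_congr rfl fun n _ => ?_
        simp only [hφ, occ_singleton, Set.indicator_apply, Set.mem_compl_iff,
          Set.mem_singleton_iff, eq_comm (a := a)]
        split_ifs <;> first | contradiction | ring)
    exact ⟨f, h1, h2, h3, δ, _, τ, [a], hτpos', Or.inr rfl, h4⟩

end Betting

/-! ### Dominated martingales on words have vanishing increments -/

section Increments

variable {α : Type*} [Fintype α] {ν h : List α → ℝ}

/-- Orthogonality of martingale increments: for `h = ν · g`, where `g` is a martingale for the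
weight `ν`, the second moment of `g` grows at a word by the second moment of its increment. -/
lemma sum_sq_increment (hν : IsInvariantWeight ν) (h0 : ∀ w, 0 ≤ h w) (hle : ∀ w, h w ≤ ν w)
    (hsum : ∀ w, h w = ∑ a, h (w ++ [a])) (w : List α) :
    ∑ a, (h (w ++ [a]) - ν (w ++ [a]) / ν w * h w) ^ 2 / ν (w ++ [a]) =
      ∑ a, h (w ++ [a]) ^ 2 / ν (w ++ [a]) - h w ^ 2 / ν w := by
  have hterm : ∀ a, (h (w ++ [a]) - ν (w ++ [a]) / ν w * h w) ^ 2 / ν (w ++ [a]) =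
      h (w ++ [a]) ^ 2 / ν (w ++ [a]) - h (w ++ [a]) * (2 * (h w / ν w)) +
        ν (w ++ [a]) * (h w / ν w) ^ 2 := by
    intro a
    rcases eq_or_ne (ν (w ++ [a])) 0 with hz | hz
    · have : h (w ++ [a]) = 0 := le_antisymm ((hle _).trans hz.le) (h0 _)
      simp [hz, this]
    · field_simp
      ring
  rw [Finset.sum_congr rfl fun a _ => hterm a, Finset.sum_add_distrib, Finset.sum_sub_distrib,
    ← Finset.sum_mul, ← Finset.sum_mul, ← hsum, ← hν.sum_right]
  rcases eq_or_ne (ν w) 0 with hz | hz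
  · simp [hz]
  · field_simp
    ring

/-- If `h ≤ ν` is compatible with extension to the right, then `h / ν` is a martingale bounded in
`L²`, so its increments tend to zero in mean. -/
theorem tendsto_sum_words_abs_increment (hν : IsInvariantWeight ν) (hν1 : ν [] = 1)
    (h0 : ∀ w, 0 ≤ h w) (hle : ∀ w, h w ≤ ν w) (hsum : ∀ w, h w = ∑ a, h (w ++ [a])) (a : α) :
    Tendsto (fun n => ∑ u : Fin n → α, |h (List.ofFn u ++ [a]) -
      ν (List.ofFn u ++ [a]) / ν (List.ofFn u) * h (List.ofFn u)|) atTop (𝓝 0) := by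
  set d : List α → α → ℝ := fun w b => h (w ++ [b]) - ν (w ++ [b]) / ν w * h w with hd
  set E : ℕ → ℝ := fun n => ∑ u : Fin n → α, h (List.ofFn u) ^ 2 / ν (List.ofFn u) with hE
  have hEsucc : ∀ n, E (n + 1) - E n =
      ∑ u : Fin n → α, ∑ b, d (List.ofFn u) b ^ 2 / ν (List.ofFn u ++ [b]) := by
    intro n
    simp only [hE]
    rw [sum_words_succ_right fun w => h w ^ 2 / ν w, ← Finset.sum_sub_distrib]
    exact Finset.sum_congr rfl fun u _ => (sum_sq_increment hν h0 hle hsum _).symm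
  have hnn : ∀ w b, 0 ≤ d w b ^ 2 / ν (w ++ [b]) := fun w b =>
    div_nonneg (sq_nonneg _) (hν.nonneg _)
  have hmono : Monotone E := monotone_nat_of_le_succ fun n => by
    rw [← sub_nonneg, hEsucc]
    exact Finset.sum_nonneg fun u _ => Finset.sum_nonneg fun b _ => hnn _ b
  have hbdd : BddAbove (Set.range E) := by
    refine ⟨1, ?_⟩
    rintro _ ⟨n, rfl⟩
    rw [← hν1, ← hν.sum_words n]
    refine Finset.sum_le_sum fun u _ => div_le_of_le_mul₀ (hν.nonneg _) (hν.nonneg _) ?_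
    rw [sq]
    exact mul_self_le_mul_self (h0 _) (hle _)
  have hlim := tendsto_atTop_ciSup hmono hbdd
  have hdiff : Tendsto (fun n => E (n + 1) - E n) atTop (𝓝 0) := by
    simpa using ((tendsto_add_atTop_iff_nat 1).2 hlim).sub hlim
  have hbound : ∀ ε > 0, ∀ n, ∑ u : Fin n → α, |d (List.ofFn u) a| ≤
      ε + (E (n + 1) - E n) / ε := by
    intro ε hε n
    -- the inequality `|x| ≤ ε + x ^ 2 / ε`, weighted
    have hpt : ∀ w, |d w a| ≤ ε * ν (w ++ [a]) + d w a ^ 2 / ν (w ++ [a]) / ε := by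
      intro w
      rcases (hν.nonneg (w ++ [a])).eq_or_lt with hz | hpos
      · have : h (w ++ [a]) = 0 := le_antisymm ((hle _).trans hz.symm.le) (h0 _)
        simp [hd, ← hz, this]
      · rw [← sq_abs, div_div, ← sub_le_iff_le_add', le_div_iff₀ (by positivity)]
        nlinarith [sq_nonneg (|d w a| - ε * ν (w ++ [a])), abs_nonneg (d w a),
          mul_nonneg (mul_pos hε hpos).le (abs_nonneg (d w a))]
    refine (Finset.sum_le_sum fun u _ => hpt (List.ofFn u)).trans ?_
    rw [Finset.sum_add_distrib, ← Finset.mul_sum, ← Finset.sum_div, hEsucc]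
    refine add_le_add ?_ (div_le_div_of_nonneg_right (Finset.sum_le_sum fun u _ => ?_) hε.le)
    · refine mul_le_of_le_one_right hε.le ?_
      rw [← hν1, ← hν.sum_words n]
      exact Finset.sum_le_sum fun u _ => hν.append_singleton_le _ a
    · exact Finset.single_le_sum (f := fun b => d (List.ofFn u) b ^ 2 / ν (List.ofFn u ++ [b]))
        (fun b _ => hnn _ b) (Finset.mem_univ a)
  rw [Metric.tendsto_atTop]
  intro ε hε
  obtain ⟨N, hN⟩ := Metric.tendsto_atTop.1 hdiff (ε / 2 * (ε / 2)) (by positivity)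
  refine ⟨N, fun n hn => ?_⟩
  have h1 := hN n hn
  rw [Real.dist_eq, sub_zero] at h1 ⊢
  rw [abs_of_nonneg (Finset.sum_nonneg fun u _ => abs_nonneg _)]
  refine (hbound (ε / 2) (half_pos hε) n).trans_lt ?_
  have h2 : (E (n + 1) - E n) / (ε / 2) < ε / 2 := by
    rw [div_lt_iff₀ (half_pos hε)]
    exact (le_abs_self _).trans_lt h1
  linarith

end Increments

/-! ### Joint frequencies of automaton states and words -/

open scoped Classical in
/-- The indicator that, at time `n`, the automaton `A` run on `s` is in state `q` and `w` occurs
in `s` at position `n`. -/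
noncomputable def jointOcc {α S : Type*} (A : DFA α S) (s : ℕ → α) (q : S) (w : List α) (n : ℕ) :
    ℝ :=
  (if A.eval (initialWord s n) = q then 1 else 0) * occ s w n

section Joint

variable {α S : Type*} {A : DFA α S} {s : ℕ → α}

lemma eval_initialWord_add (A : DFA α S) (s : ℕ → α) (n m : ℕ) :
    A.eval (initialWord s (n + m)) =
      A.evalFrom (A.eval (initialWord s n)) (initialWord (shift^[n] s) m) := by
  rw [initialWord_add, DFA.eval, DFA.evalFrom_of_append]

lemma eval_initialWord_succ (A : DFA α S) (s : ℕ → α) (n : ℕ) :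
    A.eval (initialWord s (n + 1)) = A.step (A.eval (initialWord s n)) (s n) := by
  rw [initialWord_succ, DFA.eval_append_singleton]

lemma jointOcc_nonneg (q : S) (w : List α) (n : ℕ) : 0 ≤ jointOcc A s q w n := by
  rw [jointOcc]
  exact mul_nonneg (by split_ifs <;> simp) (occ_nonneg s w n)

lemma jointOcc_le_occ (q : S) (w : List α) (n : ℕ) : jointOcc A s q w n ≤ occ s w n := by
  rw [jointOcc]
  exact mul_le_of_le_one_left (occ_nonneg s w n) (by split_ifs <;> simp)

lemma isBdd_jointOcc (A : DFA α S) (s : ℕ → α) (q : S) (w : List α) :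
    IsBdd (jointOcc A s q w) :=
  ⟨1, fun n => by
    rw [abs_of_nonneg (jointOcc_nonneg q w n)]
    exact (jointOcc_le_occ q w n).trans (occ_le_one s w n)⟩

lemma of_jointOcc_pos {q : S} {w : List α} {n : ℕ} (h : 0 < jointOcc A s q w n) :
    A.eval (initialWord s n) = q ∧ shift^[n] s ∈ wordCylinder w := by
  constructor
  · by_contra hq
    simp [jointOcc, hq] at h
  · by_contra hw
    simp [jointOcc, occ_of_notMem hw] at h

lemma sum_jointOcc [Fintype S] (w : List α) (n : ℕ) : ∑ q, jointOcc A s q w n = occ s w n := by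
  classical simp [jointOcc]

lemma jointOcc_eq_sum_right [Fintype α] (q : S) (w : List α) (n : ℕ) :
    jointOcc A s q w n = ∑ a, jointOcc A s q (w ++ [a]) n := by
  simp only [jointOcc, ← Finset.mul_sum, ← occ_eq_sum_right]

lemma jointOcc_singleton_le (q : S) (a : α) (n : ℕ) :
    jointOcc A s q [a] n ≤ jointOcc A s (A.step q a) [] (n + 1) := by
  rcases (jointOcc_nonneg (A := A) (s := s) q [a] n).eq_or_lt with h | h
  · rw [← h]; exact jointOcc_nonneg _ _ _
  · obtain ⟨hq, ha⟩ := of_jointOcc_pos h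
    rw [shift_iterate_mem_singleton] at ha
    refine (jointOcc_le_occ q _ n).trans ((occ_le_one s _ n).trans_eq ?_)
    rw [jointOcc, eval_initialWord_succ, hq, ha, if_pos rfl, occ_nil, mul_one]

open scoped Classical in
/-- The state at time `m + n` is found from the state at time `m` and the word of length `n`
read in between. -/
lemma jointOcc_add [Fintype S] [Fintype α] (q' : S) (w : List α) (m n : ℕ) :
    jointOcc A s q' w (m + n) = ∑ q, ∑ u : Fin n → α,
      (if A.evalFrom q (List.ofFn u) = q' then 1 else 0) * jointOcc A s q (List.ofFn u ++ w) m := by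
  rw [Finset.sum_comm]
  have hpt : ∀ u : Fin n → α, ∑ q, (if A.evalFrom q (List.ofFn u) = q' then (1 : ℝ) else 0) *
      jointOcc A s q (List.ofFn u ++ w) m =
        occ s (List.ofFn u) m * jointOcc A s q' w (m + n) := by
    intro u
    rw [Finset.sum_eq_single (A.eval (initialWord s m))]
    · rw [jointOcc, if_pos rfl, one_mul, occ_append, List.length_ofFn]
      by_cases hu : shift^[m] s ∈ wordCylinder (List.ofFn u)
      · rw [jointOcc, eval_initialWord_add]
        rw [mem_wordCylinder, List.length_ofFn] at hu
        rw [hu]; ring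
      · rw [occ_of_notMem hu]; ring
    · intro q _ hq
      rw [jointOcc, if_neg (Ne.symm hq)]; ring
    · exact fun h => absurd (Finset.mem_univ _) h
  rw [Finset.sum_congr rfl fun u _ => hpt u, ← Finset.sum_mul, sum_occ_words, one_mul]

open scoped Classical in
/-- Suppose that the words of `s` have the frequencies `ν`, and that the state of `A` determines
the `ν`-probabilities `π` of the next symbol as soon as `k` symbols have been read.  Then `π` also
gives the empirical frequencies of the next symbol after a state, although the state may depend
on the whole past: all but little of that dependence is on a window, by
`tendsto_sum_words_abs_increment`. -/
theorem mean_jointOcc_singleton [Fintype S] [Fintype α] {U : Ultrafilter ℕ}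
    (hU : (U : Filter ℕ) ≤ atTop) {ν : List α → ℝ} (hν : IsInvariantWeight ν) (hν1 : ν [] = 1)
    (hfreq : ∀ w, mean U (occ s w) = ν w) {π : S → α → ℝ} {k : ℕ}
    (hπ : ∀ (q : S) (u : List α) (a : α), k ≤ u.length → 0 < ν u →
      ν (u ++ [a]) / ν u = π (A.evalFrom q u) a) (q' : S) (a : α) :
    mean U (jointOcc A s q' [a]) = π q' a * mean U (jointOcc A s q' []) := by
  set y : S → List α → ℝ := fun q w => mean U (jointOcc A s q w) with hy
  have hy0 : ∀ q w, 0 ≤ y q w := fun q w =>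
    mean_nonneg U (isBdd_jointOcc A s q w) (jointOcc_nonneg q w)
  have hyle : ∀ q w, y q w ≤ ν w := fun q w => by
    rw [← hfreq w]
    exact mean_mono U (isBdd_jointOcc A s q w) (isBdd_occ s w) (jointOcc_le_occ q w)
  have hysum : ∀ q w, y q w = ∑ b, y q (w ++ [b]) := fun q w => by
    simp only [hy]
    rw [← mean_sum U _ fun b _ => isBdd_jointOcc A s q _]
    exact congrArg _ (funext fun n => jointOcc_eq_sum_right q w n)
  -- express the frequency of `q'` by the state `n` steps earlier and the word read since then
  have hshift : ∀ n w, y q' w = ∑ q, ∑ u : Fin n → α,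
      (if A.evalFrom q (List.ofFn u) = q' then 1 else 0) * y q (List.ofFn u ++ w) := by
    intro n w
    simp only [hy]
    rw [← mean_comp_add hU (isBdd_jointOcc A s q' w) n,
      show (fun m => jointOcc A s q' w (m + n)) = _ from funext fun m => jointOcc_add q' w m n,
      mean_sum U _ fun q _ => IsBdd.sum _ fun u _ => (isBdd_jointOcc A s q _).const_mul _]
    refine Finset.sum_congr rfl fun q _ => ?_
    rw [mean_sum U _ fun u _ => (isBdd_jointOcc A s q _).const_mul _]
    exact Finset.sum_congr rfl fun u _ => mean_const_mul U (isBdd_jointOcc A s q _) _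
  have hlim : Tendsto (fun n => ∑ q, ∑ u : Fin n → α, |y q (List.ofFn u ++ [a]) -
      ν (List.ofFn u ++ [a]) / ν (List.ofFn u) * y q (List.ofFn u)|) atTop (𝓝 0) := by
    simpa using tendsto_finsetSum Finset.univ fun q _ =>
      tendsto_sum_words_abs_increment hν hν1 (hy0 q) (hyle q) (hysum q) a
  have habs : |y q' [a] - π q' a * y q' []| ≤ 0 := by
    refine ge_of_tendsto hlim ?_
    filter_upwards [eventually_ge_atTop k] with n hn
    rw [hshift n [a], hshift n [], Finset.mul_sum, ← Finset.sum_sub_distrib]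
    refine (Finset.abs_sum_le_sum_abs _ _).trans (Finset.sum_le_sum fun q _ => ?_)
    rw [Finset.mul_sum, ← Finset.sum_sub_distrib]
    refine (Finset.abs_sum_le_sum_abs _ _).trans (Finset.sum_le_sum fun u _ => ?_)
    rw [List.append_nil]
    split_ifs with h
    · rcases (hν.nonneg (List.ofFn u)).eq_or_lt with hz | hpos
      · have : y q (List.ofFn u) = 0 := le_antisymm ((hyle q _).trans hz.symm.le) (hy0 q _)
        rw [this]; simp
      · rw [hπ q _ a (by simpa using hn) hpos, h]
        simp
    · simp
  exact sub_eq_zero.1 (abs_nonpos_iff.1 habs)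

end Joint

/-! ### No finite-state strategy succeeds on a distributed sequence -/

section NoSuccess

variable {α : Type*}

/-- The automaton `M` with a memory of the last `k` symbols. -/
def withMemory {Q : Type*} (M : DFA α Q) (k : ℕ) : DFA α (Q × Memory α k) where
  step q a := (M.step q.1 a, remember k (q.2.1 ++ [a]))
  start := (M.start, remember k [])
  accept := {q | q.1 ∈ M.accept}

lemma withMemory_evalFrom {Q : Type*} (M : DFA α Q) (k : ℕ) (q : Q × Memory α k) (w : List α) :
    (withMemory M k).evalFrom q w = (M.evalFrom q.1 w, remember k (q.2.1 ++ w)) := by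
  induction w using List.reverseRecOn with
  | nil =>
    refine Prod.ext rfl (Subtype.ext ?_)
    simp [remember, rtake_of_length_le q.2.2]
  | append_singleton w a ih =>
    rw [DFA.evalFrom_append_singleton, ih, DFA.evalFrom_append_singleton, ← List.append_assoc]
    exact Prod.ext rfl (remember_append k _ _)

lemma withMemory_eval {Q : Type*} (M : DFA α Q) (k : ℕ) (w : List α) :
    (withMemory M k).eval w = (M.eval w, remember k w) := by
  rw [DFA.eval, withMemory_evalFrom]
  exact Prod.ext rfl (remember_append k [] w)

lemma exists_ultrafilter_tendsto_atTop {F : ℕ → ℝ} (h : ∀ M : ℝ, ∃ᶠ N in atTop, M < F N) :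
    ∃ U : Ultrafilter ℕ, (U : Filter ℕ) ≤ atTop ∧ Tendsto F U atTop := by
  obtain ⟨φ, hφ, hF⟩ := extraction_forall_of_frequently (fun n : ℕ => h n)
  refine ⟨(Ultrafilter.of atTop).map φ, ?_, ?_⟩
  · exact (map_mono (Ultrafilter.of_le atTop)).trans hφ.tendsto_atTop
  · rw [Ultrafilter.coe_map, tendsto_map'_iff]
    exact (tendsto_atTop_mono (fun n => (hF n).le) tendsto_natCast_atTop_atTop).mono_left
      (Ultrafilter.of_le atTop)

variable [Fintype α] [TopologicalSpace α] [DiscreteTopology α]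
  [MeasurableSpace α] [BorelSpace α] {X : Set (ℕ → α)} {P : Measure (ℕ → α)}
  [IsProbabilityMeasure P] {k : ℕ}

/-- Along times at which the capital tends to infinity its mean logarithmic growth is nonnegative.
By the joint frequencies of states and symbols and `log b ≤ b - 1` it is also nonpositive, so the
betting factors are `1` on all transitions of positive frequency.  The states of positive frequency
are visited and never left again; so the capital is eventually constant. -/
theorem not_succeeds_of_isDistributed (hX : IsSubshift X)
    (hsupp : IsSupportedOn P (languageOf X)) (hMarkov : IsMarkovStep k P)
    (hinv : MeasurePreserving (shift (α := α)) P P) {s : ℕ → α} (hs : s ∈ X)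
    (hd : IsDistributed X P s) {f : List α → ℝ} (hf : IsMartingaleOn P (languageOf X) f)
    (hgen : IsGeneratedByDFA (languageOf X) f) : ¬ Succeeds f s := by
  classical
  intro hsucc
  rw [succeeds_iff] at hsucc
  obtain ⟨Q, hQ, M, b, -, hb⟩ := hgen
  obtain ⟨U, hU, hFU⟩ := exists_ultrafilter_tendsto_atTop hsucc
  have hP := isInvariantWeight_measureReal P hinv
  have hL : ∀ n, initialWord s n ∈ languageOf X := initialWord_mem_languageOf hs
  set F : ℕ → ℝ := fun n => f (initialWord s n) with hFdef
  set A := withMemory M k with hA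
  set z : ℕ → Q × Memory α k := fun n => A.eval (initialWord s n) with hz
  have hz1 : ∀ n, (z n).1 = M.eval (initialWord s n) := fun n => by
    rw [hz, hA]; simp only [withMemory_eval]
  have hz2 : ∀ n, (z n).2.1 = (initialWord s n).rtake k := fun n => by
    rw [hz, hA]; simp only [withMemory_eval]; rfl
  have hzsucc : ∀ n, z (n + 1) = A.step (z n) (s n) := eval_initialWord_succ A s
  have hFsucc : ∀ n, F (n + 1) = b (z n).1 (s n) * F n := fun n => by
    have := hL (n + 1)
    rw [initialWord_succ] at this
    rw [hz1, hFdef]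
    simp only [initialWord_succ]
    exact hb _ _ this
  have hFpos : ∀ n, 0 < F n := by
    intro n
    refine (hf.1 _ (hL n)).lt_of_ne' fun h0 => ?_
    have hzero : ∀ m, F (n + m) = 0 := fun m => by
      induction m with
      | zero => exact h0
      | succ m ih => rw [← add_assoc, hFsucc, ih, mul_zero]
    obtain ⟨N, hN, hnN⟩ := ((hsucc 0).and_eventually (eventually_ge_atTop n)).exists
    obtain ⟨m, rfl⟩ := Nat.exists_eq_add_of_le hnN
    exact hN.ne' (hzero m)
  have hbpos : ∀ n, 0 < b (z n).1 (s n) := fun n =>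
    pos_of_mul_pos_left (hFsucc n ▸ hFpos (n + 1)) (hFpos n).le
  have : Fintype (Q × Memory α k) := Fintype.ofFinite _
  -- the conditional probability of the next symbol as a function of the state
  set π : Q × Memory α k → α → ℝ := fun q a => condProb P q.2.1 [a] with hπ
  have hPpos : ∀ n, 0 < P.real (wordCylinder (initialWord s n)) := fun n =>
    hsupp.mem_iff.1 (hL n)
  have hπz : ∀ n a, π (z n) a = condProb P (initialWord s n) [a] := fun n a => by
    simp only [hπ]
    rw [hz2, ← hMarkov.condProb_rtake hinv le_rfl (hPpos n)]
  set y : Q × Memory α k → List α → ℝ := fun q w => mean U (jointOcc A s q w) with hy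
  have hy0 : ∀ q w, 0 ≤ y q w := fun q w =>
    mean_nonneg U (isBdd_jointOcc A s q w) (jointOcc_nonneg q w)
  have hfreq : ∀ w, mean U (occ s w) = P.real (wordCylinder w) := fun w =>
    mean_eq (((isDistributed_iff hX hsupp hs).1 hd w).mono_left hU)
  have hyπ : ∀ q a, y q [a] = π q a * y q [] := by
    refine mean_jointOcc_singleton hU hP (by simp) hfreq (k := k) fun q u a hu hpos => ?_
    rw [hA, withMemory_evalFrom]
    simp only [hπ, remember]
    rw [rtake_append_of_le_length hu, ← hMarkov.condProb_rtake hinv le_rfl hpos]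
    rfl
  have hvisit : ∀ q w, 0 < y q w → ∃ n, z n = q ∧ shift^[n] s ∈ wordCylinder w := by
    intro q w h
    obtain ⟨n, hn⟩ := exists_pos_of_mean_pos (isBdd_jointOcc A s q w) h
    exact ⟨n, of_jointOcc_pos hn⟩
  have hfair : ∀ n, ∑ a, π (z n) a * b (z n).1 a = 1 := by
    intro n
    have h := hf.2 _ (hL n)
    rw [Finset.sum_congr rfl fun a ha => by rw [hb _ _ (Finset.mem_filter.1 ha).2],
      Finset.sum_filter_of_ne] at h
    · refine mul_right_cancel₀ (hFpos n).ne' ?_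
      rw [Finset.sum_mul, one_mul]
      refine Eq.trans ?_ h.symm
      exact Finset.sum_congr rfl fun a _ => by rw [hπz, hz1, mul_assoc]
    · intro a _ hne
      by_contra hmem
      refine hne ?_
      rw [condProb, hsupp.measureReal_eq_zero hmem, zero_div, zero_mul]
  have hπsum : ∀ n, ∑ a, π (z n) a = 1 := fun n => by
    simp only [hπz]; exact sum_condProb hinv (hPpos n)
  -- the mean of `b - 1` vanishes because the strategy is fair
  have hgain : ∑ q, ∑ a, y q [a] * (b q.1 a - 1) = 0 := by
    refine Finset.sum_eq_zero fun q _ => ?_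
    rcases (hy0 q []).eq_or_lt with h | h
    · simp [hyπ, ← h]
    · obtain ⟨n, rfl, -⟩ := hvisit q [] h
      calc ∑ a, y (z n) [a] * (b (z n).1 a - 1)
          = y (z n) [] * (∑ a, π (z n) a * b (z n).1 a - ∑ a, π (z n) a) := by
            rw [← Finset.sum_sub_distrib, Finset.mul_sum]
            exact Finset.sum_congr rfl fun a _ => by rw [hyπ]; ring
        _ = 0 := by rw [hfair, hπsum, sub_self, mul_zero]
  -- the mean of `log b` is nonnegative because the capital tends to infinity along `U`
  have hgrowth : 0 ≤ ∑ q, ∑ a, y q [a] * Real.log (b q.1 a) := by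
    have hlog : ∀ n, Real.log (b (z n).1 (s n)) =
        ∑ q, ∑ a, Real.log (b q.1 a) * jointOcc A s q [a] n := by
      intro n
      rw [Finset.sum_eq_single (z n)]
      · simp [jointOcc, occ_singleton, hz]
      · intro q _ hq
        simp [jointOcc, show A.eval (initialWord s n) ≠ q from Ne.symm hq]
      · exact fun h => absurd (Finset.mem_univ _) h
    have hb' : ∀ q, ∀ a ∈ (Finset.univ : Finset α),
        IsBdd fun n => Real.log (b q.1 a) * jointOcc A s q [a] n :=
      fun q a _ => (isBdd_jointOcc A s q [a]).const_mul _
    have hmean : mean U (fun n => Real.log (b (z n).1 (s n))) =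
        ∑ q, ∑ a, y q [a] * Real.log (b q.1 a) := by
      rw [show (fun n => Real.log (b (z n).1 (s n))) = _ from funext hlog,
        mean_sum U _ fun q _ => IsBdd.sum _ (hb' q)]
      refine Finset.sum_congr rfl fun q _ => ?_
      rw [mean_sum U _ (hb' q)]
      exact Finset.sum_congr rfl fun a _ => by
        rw [mean_const_mul U (isBdd_jointOcc A s q [a]), mul_comm]
    have hbdd : IsBdd fun n => Real.log (b (z n).1 (s n)) := by
      rw [show (fun n => Real.log (b (z n).1 (s n))) = _ from funext hlog]
      exact IsBdd.sum _ fun q _ => IsBdd.sum _ (hb' q)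
    rw [← hmean]
    refine ge_of_tendsto (tendsto_mean U hbdd) ?_
    filter_upwards [hFU.eventually_ge_atTop (F 0)] with N hN
    refine div_nonneg ?_ (Nat.cast_nonneg N)
    have hsum : ∑ n ∈ Finset.range N, Real.log (b (z n).1 (s n)) =
        Real.log (F N) - Real.log (F 0) := by
      rw [← Finset.sum_range_sub fun n => Real.log (F n)]
      refine Finset.sum_congr rfl fun n _ => ?_
      rw [hFsucc, Real.log_mul (hbpos n).ne' (hFpos n).ne']; ring
    rw [hsum, sub_nonneg]
    exact Real.log_le_log (hFpos 0) hN
  have hterm : ∀ q a, 0 ≤ y q [a] * (b q.1 a - 1 - Real.log (b q.1 a)) := by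
    intro q a
    rcases (hy0 q [a]).eq_or_lt with h | h
    · rw [← h, zero_mul]
    · obtain ⟨n, rfl, ha⟩ := hvisit q [a] h
      rw [shift_iterate_mem_singleton] at ha
      subst ha
      exact mul_nonneg h.le (sub_nonneg.2 (Real.log_le_sub_one_of_pos (hbpos n)))
  have hone : ∀ q a, 0 < y q [a] → b q.1 a = 1 := by
    have htot : ∑ q, ∑ a, y q [a] * (b q.1 a - 1 - Real.log (b q.1 a)) = 0 := by
      refine le_antisymm ?_ (Finset.sum_nonneg fun q _ => Finset.sum_nonneg fun a _ => hterm q a)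
      simp only [mul_sub _ (b _ _ - 1), Finset.sum_sub_distrib]
      linarith
    intro q a hpos
    rw [Finset.sum_eq_zero_iff_of_nonneg fun q _ => Finset.sum_nonneg fun a _ => hterm q a] at htot
    have h1 := htot q (Finset.mem_univ q)
    rw [Finset.sum_eq_zero_iff_of_nonneg fun a _ => hterm q a] at h1
    have h2 := (mul_eq_zero.1 (h1 a (Finset.mem_univ a))).resolve_left hpos.ne'
    obtain ⟨n, rfl, ha⟩ := hvisit q [a] hpos
    rw [shift_iterate_mem_singleton] at ha
    subst ha
    by_contra hne
    linarith [Real.log_lt_sub_one_of_pos (hbpos n) hne]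
  have hnext : ∀ n, 0 < y (z n) [] → 0 < y (z n) [s n] := fun n h => by
    rw [hyπ, hπz]
    refine mul_pos ?_ h
    rw [condProb_pos_iff hinv, ← initialWord_succ]
    exact hPpos (n + 1)
  have hclosed : ∀ n, 0 < y (z n) [] → 0 < y (z (n + 1)) [] := fun n h => by
    refine (hnext n h).trans_le ?_
    rw [hzsucc]
    simp only [hy]
    rw [← mean_comp_succ hU (isBdd_jointOcc A s _ [])]
    exact mean_mono U (isBdd_jointOcc A s _ _) ((isBdd_jointOcc A s _ _).comp _)
      (jointOcc_singleton_le _ _)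
  obtain ⟨n₀, hn₀⟩ : ∃ n, 0 < y (z n) [] := by
    have hsum : ∑ q, y q [] = 1 := by
      simp only [hy]
      rw [← mean_sum U _ fun q _ => isBdd_jointOcc A s q [],
        show (fun n => ∑ q, jointOcc A s q [] n) = fun _ => 1 from
          funext fun n => by rw [sum_jointOcc, occ_nil], mean_one hU]
    obtain ⟨q, -, hq⟩ := Finset.exists_ne_zero_of_sum_ne_zero (hsum.trans_ne one_ne_zero)
    have hpos := (hy0 q []).lt_of_ne' hq
    obtain ⟨n, rfl, -⟩ := hvisit q [] hpos
    exact ⟨n, hpos⟩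
  have hconst : ∀ m, 0 < y (z (n₀ + m)) [] ∧ F (n₀ + m) = F n₀ := fun m => by
    induction m with
    | zero => exact ⟨hn₀, rfl⟩
    | succ m ih =>
      refine ⟨hclosed _ ih.1, ?_⟩
      rw [← add_assoc, hFsucc, hone _ _ (hnext _ ih.1), one_mul, ih.2]
  obtain ⟨N, hN, hnN⟩ :=
    ((hFU.eventually_gt_atTop (F n₀)).and (hU (eventually_ge_atTop n₀))).exists
  obtain ⟨m, rfl⟩ := Nat.exists_eq_add_of_le hnN
  exact hN.ne' (hconst m).2

end NoSuccess

end SymbolicDynamics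

theorem theorem2 {α : Type*} [Fintype α] [TopologicalSpace α] [DiscreteTopology α]
    [MeasurableSpace α] [BorelSpace α]
    (X : Set (ℕ → α)) (hX : SymbolicDynamics.IsSubshift X)
    (P : Measure (ℕ → α)) [IsProbabilityMeasure P]
    (hsupp : SymbolicDynamics.IsSupportedOn P (SymbolicDynamics.languageOf X))
    (k : ℕ) (hMarkov : SymbolicDynamics.IsMarkovStep k P)
    (hinv : MeasurePreserving (SymbolicDynamics.shift (α := α)) P P)
    (hirr : SymbolicDynamics.IsIrreducibleMeasure P)
    (s : ℕ → α) (hs : s ∈ X) :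
    (SymbolicDynamics.IsDistributed X P s ↔
      ¬ ∃ f : List α → ℝ,
        SymbolicDynamics.IsMartingaleOn P (SymbolicDynamics.languageOf X) f ∧
        SymbolicDynamics.IsGeneratedByDFA (SymbolicDynamics.languageOf X) f ∧
        SymbolicDynamics.Succeeds f s) ∧
    (¬ SymbolicDynamics.IsDistributed X P s →
      ∃ f : List α → ℝ,
        SymbolicDynamics.IsMartingaleOn P (SymbolicDynamics.languageOf X) f ∧
        SymbolicDynamics.IsGeneratedByDFA (SymbolicDynamics.languageOf X) f ∧
        SymbolicDynamics.Succeeds f s ∧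
        ∃ (δ : ℚ) (p : ℝ) (τ ρ : List α),
          0 < P (SymbolicDynamics.wordCylinder τ) ∧
          (p = SymbolicDynamics.condProb P τ ρ ∨ p = 1 - SymbolicDynamics.condProb P τ ρ) ∧
          0 < p ∧ p < 1 ∧ 0 < δ ∧ (δ : ℝ) * p / (1 - p) < 1 ∧
          SymbolicDynamics.BettingFactorsIn (SymbolicDynamics.languageOf X) f
            {1, 1 + (δ : ℝ), 1 - (δ : ℝ) * p / (1 - p)}) := by
  have hnot := SymbolicDynamics.exists_succeeding_martingale_of_not_isDistributed hX hsupp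
    hMarkov hinv hirr hs
  refine ⟨⟨?_, fun h => ?_⟩, hnot⟩
  · rintro hd ⟨f, hf, hgen, hsucc⟩
    exact SymbolicDynamics.not_succeeds_of_isDistributed hX hsupp hMarkov hinv hs hd hf hgen hsucc
  · by_contra hnd
    obtain ⟨f, hf, hgen, hsucc, -⟩ := hnot hnd
    exact h ⟨f, hf, hgen, hsucc⟩
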